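/- **Theorem (Signal boosting with 1-step QAOA).** Let $q\ge 1$ be an integer (the order of the tensor). For each $n$ let $u\sim\mathrm{Unif}(\{\pm1\}^n)$ be a hidden signal, and let $$Y=\frac{\lambda_n}{n^{q/2}}\,u^{\otimes q}+\frac1{\sqrt n}\,W\in\mathbb R^{n^q},$$ where $W$ has i.i.d. $\mathcal N(0,1)$ entries. Let $\theta_1,\dots,\theta_n$ be i.i.d. with $\theta_j=\pi/4-\delta$ with probability $k_n/n$ and $\theta_j=\pi/4$ with probability $1-k_n/n$, with $u,\theta,W$ independent. On $n$ qubits (computational basis $|z\rangle$, $z\in\{\pm1\}^n$) define $$|s_{\rm biased}\rangle=\bigotimes_{j=1}^n\big(\cos\theta_j|u_j\rangle+\sin\theta_j|-u_j\rangle\big),\qquad |\gamma,\beta\rangle_{\rm biased}=e^{-i\beta B}e^{-i\gamma C}|s_{\rm biased}\rangle,$$ where $B=\sum_j X_j$ is the sum of the Pauli $X$ operators and $C$ is the diagonal operator with $C|z\rangle=\frac{\langle Y,z^{\otimes q}\rangle}{n^{(q-2)/2}}|z\rangle$. Given $(u,\theta,Y)$, let $\hat u\in\{\pm1\}^n$ be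 a computational-basis measurement of $|\gamma,\beta\rangle_{\rm biased}$, so that $\hat u=z$ with probability $|\langle z|\gamma,\beta\rangle_{\rm biased}|^2$, and let $\mathcal R_n=\hat u^\top u/n$. Fix $\gamma>0$, $\beta\in[0,2\pi]$, $\delta\in[0,\pi/4]$ and $c\in(1/2,1)$. Let $0\le k_n\le n$ be real numbers with $k_n=\Theta(n^c)$, and let $\lambda_n$ be real numbers with $$\lim_{n\to\infty}\lambda_n/n^{(1-c)(q-1)}=\Lambda\in\mathbb R .$$ Then, over the randomness of $u$, $\theta$, $W$ and the quantum measurement, $$\mathcal R_n-e^{-2q\gamma^2}\sin(2\beta)\,\sin\!\Big(2q\Lambda\gamma\,\big(\tfrac{k_n}{n^c}\sin(2\delta)\big)^{q-1}\Big)\ \longrightarrow\ 0\quad\text{in probability as } n\to\infty.$$ In particular, if $k_n/n^c\to1$ (for example $k_n=n^c$), then $$\mathcal R_n\ \longrightarrow\ e^{-2q\gamma^2}\sin(2\beta)\,\sin\!\big(2q\Lambda\gamma\sin^{q-1}(2\delta)\big)\quad\text{in probability as } n\to\infty.$$ -/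

import Mathlib

open MeasureTheory ProbabilityTheory Filter Topology Asymptotics
open scoped ENNReal Matrix

noncomputable section

namespace QAOA

/-! ### Spiked tensor model -/

/-- Bit strings `{+1, -1}ⁿ`. -/
abbrev Spins (n : ℕ) : Type := Fin n → ℤˣ

/-- The real number `+1` or `-1`. -/
def sgn (s : ℤˣ) : ℝ := ((s : ℤ) : ℝ)

/-- Order-`q` tensors in dimension `n`: arrays indexed by `(j₁, …, j_q)`. -/
abbrev Tensor (n q : ℕ) : Type := (Fin q → Fin n) → ℝ

/-- The rank-one tensor `z^{⊗ q}`. -/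
def tensorPow {n : ℕ} (q : ℕ) (z : Spins n) : Tensor n q := fun J => ∏ i, sgn (z (J i))

/-- `Y = (lam / n^{q/2}) u^{⊗ q} + n^{-1/2} W`. -/
def spikedTensor {n q : ℕ} (lam : ℝ) (u : Spins n) (W : Tensor n q) : Tensor n q :=
  fun J => lam / (n : ℝ) ^ ((q : ℝ) / 2) * tensorPow q u J + 1 / √(n : ℝ) * W J

/-- `C(z) = ⟨Y, z^{⊗ q}⟩ / n^{(q-2)/2}`. -/
def cost {n q : ℕ} (Y : Tensor n q) (z : Spins n) : ℝ :=
  (∑ J, Y J * tensorPow q z J) / (n : ℝ) ^ (((q : ℝ) - 2) / 2)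

/-- `zᵀ u / n`. -/
def overlap {n : ℕ} (z u : Spins n) : ℝ := (∑ i, sgn (z i) * sgn (u i)) / (n : ℝ)

/-! ### Qubits and one QAOA step

States of `n` qubits are vectors in `ℂ^{2ⁿ}`, indexed by `Spins n` (computational basis). -/

/-- The single-qubit basis vector `|a⟩`. -/
def ket (a : ℤˣ) : ℤˣ → ℂ := Pi.single a 1

/-- The Pauli matrix `σ_x`. -/
def sigmaX : Matrix ℤˣ ℤˣ ℂ := Matrix.of fun a b => if a = b then 0 else 1

/-- `X_k = I ⊗ ⋯ ⊗ σ_x ⊗ ⋯ ⊗ I`, with `σ_x` in position `k`; the entries of a Kronecker product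
are the products of the entries of its factors. -/
def pauliX {n : ℕ} (k : Fin n) : Matrix (Spins n) (Spins n) ℂ :=
  Matrix.of fun z w => ∏ j, (if j = k then sigmaX else 1) (z j) (w j)

/-- `B = ∑ X_j`. -/
def mixer (n : ℕ) : Matrix (Spins n) (Spins n) ℂ := ∑ j, pauliX j

/-- The diagonal operator `C |z⟩ = C(z) |z⟩`. -/
def costOp {n : ℕ} (C : Spins n → ℝ) : Matrix (Spins n) (Spins n) ℂ :=
  Matrix.diagonal fun z => (C z : ℂ)

/-- `e^{-iβB} e^{-iγC} ψ`, with matrix exponentials. -/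
def qaoaStep {n : ℕ} (γ β : ℝ) (C : Spins n → ℝ) (ψ : Spins n → ℂ) : Spins n → ℂ :=
  NormedSpace.exp ((-(Complex.I * (β : ℂ))) • mixer n) *ᵥ
    (NormedSpace.exp ((-(Complex.I * (γ : ℂ))) • costOp C) *ᵥ ψ)

/-- `⊗_j (cos θ_j |u_j⟩ + sin θ_j |-u_j⟩)`. -/
def biasedState {n : ℕ} (u : Spins n) (θ : Fin n → ℝ) : Spins n → ℂ :=
  fun z => ∏ j, ((Real.cos (θ j) : ℂ) • ket (u j) + (Real.sin (θ j) : ℂ) • ket (-(u j))) (z j)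

/-- Distribution of a computational-basis measurement: `z` has probability `|ψ_z|²`. -/
def bornMeasure {n : ℕ} (ψ : Spins n → ℂ) : Measure (Spins n) :=
  ∑ z, ENNReal.ofReal (‖ψ z‖ ^ 2) • Measure.dirac z

/-! ### The randomness -/

/-- The signal `u`, the angles `θ` and the noise tensor `W`. -/
abbrev Disorder (n q : ℕ) : Type := Spins n × (Fin n → ℝ) × Tensor n q

/-- Law of one angle: `π/4` with probability `1 - p` and `π/4 - δ` with probability `p`. -/
def angleLaw (p δ : ℝ) : Measure ℝ :=
  ENNReal.ofReal (1 - p) • Measure.dirac (Real.pi / 4) +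
    ENNReal.ofReal p • Measure.dirac (Real.pi / 4 - δ)

/-- `u` uniform on `{+1, -1}ⁿ`, `θ_j` i.i.d., `W_J` i.i.d. standard Gaussian, all independent. -/
def disorderLaw (n q : ℕ) (p δ : ℝ) : Measure (Disorder n q) :=
  (PMF.uniformOfFintype (Spins n)).toMeasure.prod
    ((Measure.pi fun _ : Fin n => angleLaw p δ).prod
      (Measure.pi fun _ : Fin q → Fin n => gaussianReal 0 1))

/-- The biased 1-step QAOA state `e^{-iβB} e^{-iγC} |s_biased⟩`. -/
def qaoaState {n q : ℕ} (γ β lam : ℝ) (ω : Disorder n q) : Spins n → ℂ :=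
  qaoaStep γ β (cost (spikedTensor lam ω.1 ω.2.2)) (biasedState ω.1 ω.2.1)

instance : DiscreteMeasurableSpace ℤˣ where
  forall_measurableSet s := ⟨Units.val '' s, trivial, by
    ext x; simp [Units.val_inj]⟩

lemma qaoaStep_apply {n : ℕ} (γ β : ℝ) (C : Spins n → ℝ) (ψ : Spins n → ℂ) (z : Spins n) :
    qaoaStep γ β C ψ z = ∑ w, NormedSpace.exp ((-(Complex.I * (β : ℂ))) • mixer n) z w *
      (Complex.exp (-(Complex.I * (γ : ℂ)) * (C w : ℂ)) * ψ w) := by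
  unfold qaoaStep costOp
  rw [← Matrix.diagonal_smul, Matrix.exp_diagonal]
  simp only [Matrix.mulVec, dotProduct, Matrix.diagonal_apply]
  refine Finset.sum_congr rfl fun w _ => ?_
  simp [← Complex.exp_eq_exp_ℂ]

lemma measurable_qaoaState {n q : ℕ} (γ β lam : ℝ) (z : Spins n) :
    Measurable fun ω : Disorder n q => qaoaState γ β lam ω z := by
  refine measurable_from_prod_countable_right fun u => ?_
  unfold qaoaState
  simp only [qaoaStep_apply, biasedState, cost, spikedTensor, Pi.add_apply, Pi.smul_apply,
    smul_eq_mul]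
  fun_prop

/-- Given the disorder, the sample `z` is drawn by measuring the biased 1-step QAOA state. -/
def measurementKernel (n q : ℕ) (γ β lam : ℝ) : Kernel (Disorder n q) (Spins n) where
  toFun ω := bornMeasure (qaoaState γ β lam ω)
  measurable' := by
    refine Measure.measurable_of_measurable_coe _ fun s hs => ?_
    simp only [bornMeasure, Measure.coe_finsetSum, Finset.sum_apply, Measure.smul_apply]
    have := fun z => measurable_qaoaState (n := n) (q := q) γ β lam z
    fun_prop

/-- Joint law of the disorder `(u, θ, W)` and the measured bit string. -/
def jointLaw (n q : ℕ) (γ β δ p lam : ℝ) : Measure (Disorder n q × Spins n) :=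
  disorderLaw n q p δ ⊗ₘ measurementKernel n q γ β lam

/-! ### The laws above are probability laws -/

instance (p δ : ℝ) : IsFiniteMeasure (angleLaw p δ) := ⟨by simp [angleLaw]⟩

lemma isProbabilityMeasure_angleLaw {p : ℝ} (hp : p ∈ Set.Icc (0 : ℝ) 1) (δ : ℝ) :
    IsProbabilityMeasure (angleLaw p δ) := ⟨by
  simp [angleLaw, ← ENNReal.ofReal_add (sub_nonneg.2 hp.2) hp.1]⟩

lemma isProbabilityMeasure_disorderLaw (n q : ℕ) {p : ℝ} (hp : p ∈ Set.Icc (0 : ℝ) 1) (δ : ℝ) :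
    IsProbabilityMeasure (disorderLaw n q p δ) := by
  have := isProbabilityMeasure_angleLaw hp δ
  unfold disorderLaw
  infer_instance

lemma pauliX_isHermitian {n : ℕ} (k : Fin n) : (pauliX k).IsHermitian := by
  ext z w
  simp only [pauliX, Matrix.conjTranspose_apply, Matrix.of_apply, star_prod]
  refine Finset.prod_congr rfl fun j _ => ?_
  by_cases h : j = k
  · by_cases h' : z j = w j
    · simp [h, sigmaX, h ▸ h']
    · simp [h, sigmaX, h ▸ h', h ▸ (Ne.symm h')]
  · by_cases h' : z j = w j
    · simp [h, Matrix.one_apply, h']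
    · simp [h, h', Ne.symm h']

open scoped Matrix.Norms.Operator in
lemma exp_isUnitary {n : ℕ} {A : Matrix (Spins n) (Spins n) ℂ} (hA : A.IsHermitian) (t : ℝ) :
    (NormedSpace.exp ((-(Complex.I * (t : ℂ))) • A))ᴴ *
      NormedSpace.exp ((-(Complex.I * (t : ℂ))) • A) = 1 := by
  rw [← Matrix.exp_conjTranspose, Matrix.conjTranspose_smul, hA.eq, ← Matrix.exp_add_of_commute]
  · rw [← add_smul]; simp
  · exact ((Commute.refl A).smul_left _).smul_right _

lemma normSq_mulVec {n : ℕ} {U : Matrix (Spins n) (Spins n) ℂ} (hU : Uᴴ * U = 1)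
    (ψ : Spins n → ℂ) : ∑ z, ‖(U *ᵥ ψ) z‖ ^ 2 = ∑ z, ‖ψ z‖ ^ 2 := by
  have key : ∀ φ : Spins n → ℂ, ((∑ z, ‖φ z‖ ^ 2 : ℝ) : ℂ) = star φ ⬝ᵥ φ := by
    intro φ
    simp [dotProduct, ← Complex.conj_mul']
  have h : ((∑ z, ‖(U *ᵥ ψ) z‖ ^ 2 : ℝ) : ℂ) = ((∑ z, ‖ψ z‖ ^ 2 : ℝ) : ℂ) := by
    rw [key, key, Matrix.star_mulVec, Matrix.dotProduct_mulVec, Matrix.vecMul_vecMul, hU,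
      Matrix.vecMul_one]
  exact_mod_cast h

lemma normSq_biasedState {n : ℕ} (u : Spins n) (θ : Fin n → ℝ) :
    ∑ z, ‖biasedState u θ z‖ ^ 2 = 1 := by
  simp only [biasedState, norm_prod, ← Finset.prod_pow]
  rw [← Fintype.prod_sum fun (j : Fin n) (s : ℤˣ) =>
    ‖((Real.cos (θ j) : ℂ) • ket (u j) + (Real.sin (θ j) : ℂ) • ket (-(u j))) s‖ ^ 2]
  refine Finset.prod_eq_one fun j _ => ?_
  have huniv : (Finset.univ : Finset ℤˣ) = {1, -1} := rfl
  have h1 : (1 : ℤˣ) ≠ -1 := by decide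
  rw [huniv, Finset.sum_pair h1]
  rcases Int.units_eq_one_or (u j) with h | h <;>
    simp [h, ket, -Complex.ofReal_cos, -Complex.ofReal_sin]

lemma normSq_qaoaState {n q : ℕ} (γ β lam : ℝ) (ω : Disorder n q) :
    ∑ z, ‖qaoaState γ β lam ω z‖ ^ 2 = 1 := by
  unfold qaoaState qaoaStep
  have hB : (mixer n).IsHermitian := by
    simp only [mixer, Matrix.IsHermitian, Matrix.conjTranspose_sum]
    exact Finset.sum_congr rfl fun k _ => pauliX_isHermitian k
  have hC : (costOp (cost (spikedTensor lam ω.1 ω.2.2))).IsHermitian :=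
    Matrix.isHermitian_diagonal_of_self_adjoint _ (by ext z; simp)
  rw [normSq_mulVec (exp_isUnitary hB β), normSq_mulVec (exp_isUnitary hC γ),
    normSq_biasedState]

instance (n q : ℕ) (γ β lam : ℝ) : IsMarkovKernel (measurementKernel n q γ β lam) := ⟨fun ω => ⟨by
  change bornMeasure (qaoaState γ β lam ω) Set.univ = 1
  simp only [bornMeasure, Measure.coe_finsetSum, Finset.sum_apply, Measure.smul_apply,
    measure_univ, smul_eq_mul, mul_one]
  rw [← ENNReal.ofReal_sum_of_nonneg fun _ _ => by positivity, normSq_qaoaState,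
    ENNReal.ofReal_one]⟩⟩

lemma isProbabilityMeasure_jointLaw (n q : ℕ) (γ β δ lam : ℝ) {p : ℝ}
    (hp : p ∈ Set.Icc (0 : ℝ) 1) : IsProbabilityMeasure (jointLaw n q γ β δ p lam) := by
  have := isProbabilityMeasure_disorderLaw n q hp δ
  unfold jointLaw
  infer_instance

end QAOA

end

namespace QAOA

/-! ### Spins and flips -/

/-! The proof is a second moment method, run for each fixed signal `u`. Conjugating `Z_j` by the
mixer gives `cos 2β Z_j + i sin 2β X_j Z_j` (`pauliZ_mul_exp_mixer`). Hence the first two moments of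
the measured spins are combinations of sums `∑ x, (∏_B x_i) ⟨φ|x⟩⟨flip A x|φ⟩`, where `φ` is the
state before the mixer, `A ⊆ B` and `A` has at most two elements (`first_moment`, `second_moment`).

Their disorder average is explicit (`integral_coherence`). The Gaussian noise contributes a damping
factor, which tends to `e^{-2qγ²}` per flipped spin. The angles turn `x` into independent spins:
fair on `A`, with mean `μ = (k/n) sin 2δ` off `A`. What remains is the phase `γ lam / n^(q-1) * (m^q
- (m - 2σ)^q)`, where `m` is the total magnetization and `σ` that of `A`.

Now `m` has mean of order at most `n^c` and fluctuations of order `√n`, negligible against `n^c`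
because `c > 1/2`. So the phase is close to `σ y` with `y = 2qΛγ ((k/n^c) sin 2δ)^(q-1)`
(`eventually_phase_close`). A linear phase factorizes over the spins: each site of `A` gives `i sin
y`, and each site of `B \ A` gives `μ`, which vanishes because `c < 1`. With `s = e^{-2qγ²} sin y`
the average is therefore nearly `(i s)^|A|` if `A = B` and nearly zero otherwise
(`eventually_coherenceAverage_close`).

Consequently a spin aligned with the signal has mean close to `r = sin 2β * s`, and two distinct
ones have correlation close to `r²`. The mean square of the overlap minus `r` tends to zero
(`integral_expect_sq_le`), and Markov's inequality concludes. -/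

@[simp] lemma sgn_one : sgn 1 = 1 := by simp [sgn]

@[simp] lemma sgn_neg (s : ℤˣ) : sgn (-s) = -sgn s := by simp [sgn]

@[simp] lemma sgn_mul (s t : ℤˣ) : sgn (s * t) = sgn s * sgn t := by simp [sgn]

@[simp] lemma sgn_mul_self (s : ℤˣ) : sgn s * sgn s = 1 := by
  rw [← sgn_mul, Int.units_mul_self, sgn_one]

@[simp] lemma abs_sgn (s : ℤˣ) : |sgn s| = 1 := by
  rcases Int.units_eq_one_or s with h | h <;> simp [h]

lemma sum_units {M : Type*} [AddCommMonoid M] (f : ℤˣ → M) : ∑ s, f s = f 1 + f (-1) := by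
  have huniv : (Finset.univ : Finset ℤˣ) = {1, -1} := rfl
  rw [huniv, Finset.sum_pair (by decide)]

/-- Flip the spins with index in `A`. -/
def flip {n : ℕ} (A : Finset (Fin n)) (z : Spins n) : Spins n :=
  fun i => if i ∈ A then -z i else z i

lemma flip_apply {n : ℕ} (A : Finset (Fin n)) (z : Spins n) (i : Fin n) :
    flip A z i = if i ∈ A then -z i else z i := rfl

@[simp] lemma flip_empty {n : ℕ} (z : Spins n) : flip ∅ z = z := by
  ext i; simp [flip_apply]

lemma flip_mul {n : ℕ} (A : Finset (Fin n)) (z w : Spins n) : flip A z * w = flip A (z * w) := by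
  funext i
  by_cases h : i ∈ A <;> simp [flip_apply, h]

@[simp] lemma flip_flip {n : ℕ} (A : Finset (Fin n)) (z : Spins n) : flip A (flip A z) = z := by
  funext i
  by_cases h : i ∈ A <;> simp [flip_apply, h]

lemma flip_flip_singleton {n : ℕ} {j l : Fin n} (h : j ≠ l) (z : Spins n) :
    flip {l} (flip {j} z) = flip {j, l} z := by
  funext i
  by_cases h1 : i = j
  · subst h1; simp [flip_apply, h]
  · by_cases h2 : i = l <;> simp [flip_apply, h1, h2, Ne.symm h]

lemma flip_singleton_comm {n : ℕ} (j l : Fin n) (z : Spins n) :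
    flip {l} (flip {j} z) = flip {j} (flip {l} z) := by
  by_cases h : j = l
  · rw [h]
  · rw [flip_flip_singleton h, flip_flip_singleton (Ne.symm h), Finset.pair_comm]

/-! ### Pauli operators in the Heisenberg picture -/

lemma pauliX_apply {n : ℕ} (k : Fin n) (z w : Spins n) :
    pauliX k z w = if w = flip {k} z then 1 else 0 := by
  have h : ∀ j, (if j = k then sigmaX else 1) (z j) (w j) =
      if w j = flip {k} z j then (1 : ℂ) else 0 := by
    intro j
    by_cases hj : j = k
    · subst hj
      simp only [if_true, sigmaX, Matrix.of_apply, flip_apply, Finset.mem_singleton]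
      rcases Int.units_eq_one_or (z j) with h1 | h1 <;>
        rcases Int.units_eq_one_or (w j) with h2 | h2 <;> simp [h1, h2]
    · simp [hj, flip_apply, Matrix.one_apply, eq_comm]
  simp only [pauliX, Matrix.of_apply, h, Finset.prod_boole, Finset.mem_univ, true_imp_iff,
    funext_iff]

lemma pauliX_mulVec {n : ℕ} (k : Fin n) (ψ : Spins n → ℂ) (z : Spins n) :
    (pauliX k *ᵥ ψ) z = ψ (flip {k} z) := by
  simp [Matrix.mulVec, dotProduct, pauliX_apply]

lemma matrix_ext_mulVec {n : ℕ} {M N : Matrix (Spins n) (Spins n) ℂ}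
    (h : ∀ ψ z, (M *ᵥ ψ) z = (N *ᵥ ψ) z) : M = N :=
  Matrix.ext_of_mulVec_single fun _ => funext fun z => h _ z

lemma pauliX_mul_self {n : ℕ} (k : Fin n) : pauliX k * pauliX k = 1 :=
  matrix_ext_mulVec fun ψ z => by simp [← Matrix.mulVec_mulVec, pauliX_mulVec]

lemma pauliX_commute {n : ℕ} (j k : Fin n) : Commute (pauliX j) (pauliX k) :=
  matrix_ext_mulVec fun ψ z => by
    simp only [← Matrix.mulVec_mulVec, pauliX_mulVec]
    rw [flip_singleton_comm]

/-- The Pauli `Z` operator on qubit `j`. -/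
noncomputable def pauliZ {n : ℕ} (j : Fin n) : Matrix (Spins n) (Spins n) ℂ :=
  Matrix.diagonal fun z => (sgn (z j) : ℂ)

lemma pauliZ_mulVec {n : ℕ} (j : Fin n) (ψ : Spins n → ℂ) (z : Spins n) :
    (pauliZ j *ᵥ ψ) z = sgn (z j) * ψ z := by
  simp [pauliZ, Matrix.mulVec_diagonal]

lemma pauliZ_mul_self {n : ℕ} (j : Fin n) : pauliZ j * pauliZ j = 1 :=
  matrix_ext_mulVec fun ψ z => by
    simp only [← Matrix.mulVec_mulVec, pauliZ_mulVec, Matrix.one_mulVec]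
    rw [← mul_assoc, ← Complex.ofReal_mul, sgn_mul_self]; simp

lemma pauliZ_mul_pauliX {n : ℕ} (j k : Fin n) :
    pauliZ j * pauliX k = (if k = j then -pauliX k else pauliX k) * pauliZ j :=
  matrix_ext_mulVec fun ψ z => by
    by_cases h : k = j
    · subst h
      simp [← Matrix.mulVec_mulVec, pauliX_mulVec, pauliZ_mulVec, Matrix.neg_mulVec, flip_apply]
    · simp [← Matrix.mulVec_mulVec, pauliX_mulVec, pauliZ_mulVec, h, flip_apply, Ne.symm h]

/-- `Z_j` anticommutes with `X_j` and commutes with every other `X_k`, so only one summand changes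
sign. -/
lemma pauliZ_mul_mixer {n : ℕ} (j : Fin n) :
    pauliZ j * mixer n = (mixer n - (2 : ℂ) • pauliX j) * pauliZ j := by
  have h : mixer n - (2 : ℂ) • pauliX j =
      ∑ k, if k = j then -pauliX k else pauliX k := by
    have h2 : ∀ k : Fin n, (if k = j then -pauliX k else pauliX k) =
        pauliX k - if k = j then (2 : ℂ) • pauliX k else 0 := by
      intro k
      split_ifs
      · rw [two_smul]; abel
      · simp
    simp only [h2, Finset.sum_sub_distrib, mixer]
    simp
  rw [h, Finset.sum_mul, mixer, Finset.mul_sum]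
  exact Finset.sum_congr rfl fun k _ => pauliZ_mul_pauliX j k

open scoped Matrix.Norms.Operator in
lemma exp_smul_of_mul_self_eq_one {ι : Type*} [Fintype ι] [DecidableEq ι] {X : Matrix ι ι ℂ}
    (hX : X * X = 1) (s : ℂ) :
    NormedSpace.exp (s • X) = Complex.cosh s • (1 : Matrix ι ι ℂ) + Complex.sinh s • X := by
  have h := NormedSpace.exp_series_hasSum_exp' (𝕂 := ℂ) (s • X)
  have he : ∀ k, X ^ (2 * k) = 1 := fun k => by rw [pow_mul, pow_two, hX, one_pow]
  refine h.unique (HasSum.even_add_odd ?_ ?_)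
  · refine Eq.subst (motive := fun f => HasSum f _) (funext fun k => ?_)
      ((Complex.hasSum_cosh s).smul_const (1 : Matrix ι ι ℂ))
    rw [smul_pow, he, smul_smul, div_eq_inv_mul]
  · refine Eq.subst (motive := fun f => HasSum f _) (funext fun k => ?_)
      ((Complex.hasSum_sinh s).smul_const X)
    rw [smul_pow, pow_succ X, he, one_mul, smul_smul, div_eq_inv_mul]

/-- The operator `cos 2β Z_j + i sin 2β X_j Z_j`, which is `e^{iβB} Z_j e^{-iβB}`. -/
noncomputable def heisenbergZ {n : ℕ} (β : ℝ) (j : Fin n) : Matrix (Spins n) (Spins n) ℂ :=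
  (Complex.cos (2 * β) • 1 + (Complex.I * Complex.sin (2 * β)) • pauliX j) * pauliZ j

lemma heisenbergZ_mulVec {n : ℕ} (β : ℝ) (j : Fin n) (ψ : Spins n → ℂ) (z : Spins n) :
    (heisenbergZ β j *ᵥ ψ) z = sgn (z j) *
      (Complex.cos (2 * β) * ψ z - Complex.I * Complex.sin (2 * β) * ψ (flip {j} z)) := by
  simp [heisenbergZ, ← Matrix.mulVec_mulVec, Matrix.add_mulVec, Matrix.smul_mulVec, pauliX_mulVec,
    pauliZ_mulVec, flip_apply]
  ring

/-- With `t = -iβ`, conjugation by `Z_j` turns `e^{tB}` into `e^{t(B - 2X_j)}`. As `X_j` commutes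
with `B`, this splits as `e^{tB} e^{2iβ X_j}`, and `X_j² = 1` makes the last factor a cosine and a
sine. -/
lemma pauliZ_mul_exp_mixer {n : ℕ} (β : ℝ) (j : Fin n) :
    pauliZ j * NormedSpace.exp ((-(Complex.I * (β : ℂ))) • mixer n) =
      NormedSpace.exp ((-(Complex.I * (β : ℂ))) • mixer n) * heisenbergZ β j := by
  set t : ℂ := -(Complex.I * (β : ℂ)) with ht
  let Z : (Matrix (Spins n) (Spins n) ℂ)ˣ :=
    ⟨pauliZ j, pauliZ j, pauliZ_mul_self j, pauliZ_mul_self j⟩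
  have h1 := Matrix.exp_units_conj Z (t • mixer n)
  have h2 : (Z : Matrix (Spins n) (Spins n) ℂ) * (t • mixer n) * (Z⁻¹ : (Matrix _ _ ℂ)ˣ) =
      t • mixer n + (-(2 * t)) • pauliX j := by
    change pauliZ j * (t • mixer n) * pauliZ j = _
    rw [Matrix.mul_smul, pauliZ_mul_mixer, Matrix.smul_mul, mul_assoc, pauliZ_mul_self, mul_one,
      smul_sub, smul_smul, sub_eq_add_neg, ← neg_smul]
    ring_nf
  have hcomm : Commute (mixer n) (pauliX j) :=
    Commute.sum_left _ _ _ fun k _ => pauliX_commute k j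
  rw [h2, Matrix.exp_add_of_commute _ _ ((hcomm.smul_left _).smul_right _),
    exp_smul_of_mul_self_eq_one (pauliX_mul_self j)] at h1
  have h3 : pauliZ j * NormedSpace.exp (t • mixer n) =
      (pauliZ j * NormedSpace.exp (t • mixer n) * pauliZ j) * pauliZ j := by
    rw [mul_assoc, pauliZ_mul_self, mul_one]
  rw [h3]
  change _ = pauliZ j * NormedSpace.exp (t • mixer n) * pauliZ j at h1
  rw [← h1, heisenbergZ, mul_assoc]
  have h4 : -(2 * t) = (2 * β : ℂ) * Complex.I := by rw [ht]; ring
  rw [h4, Complex.cosh_mul_I, Complex.sinh_mul_I, mul_comm Complex.I]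

lemma star_dotProduct_isometry {n : ℕ} {U : Matrix (Spins n) (Spins n) ℂ} (hU : Uᴴ * U = 1)
    (φ χ : Spins n → ℂ) : star (U *ᵥ φ) ⬝ᵥ (U *ᵥ χ) = star φ ⬝ᵥ χ := by
  rw [Matrix.star_mulVec, Matrix.dotProduct_mulVec, Matrix.vecMul_vecMul, hU, Matrix.vecMul_one]

lemma mixer_isHermitian (n : ℕ) : (mixer n).IsHermitian := by
  simp only [mixer, Matrix.IsHermitian, Matrix.conjTranspose_sum]
  exact Finset.sum_congr rfl fun k _ => pauliX_isHermitian k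

/-- The state `e^{-iγC} ψ`. -/
noncomputable def phaseState {n : ℕ} (γ : ℝ) (C : Spins n → ℝ) (ψ : Spins n → ℂ) : Spins n → ℂ :=
  fun z => Complex.exp (-(Complex.I * (γ : ℂ)) * (C z : ℂ)) * ψ z

lemma qaoaStep_eq {n : ℕ} (γ β : ℝ) (C : Spins n → ℝ) (ψ : Spins n → ℂ) :
    qaoaStep γ β C ψ =
      NormedSpace.exp ((-(Complex.I * (β : ℂ))) • mixer n) *ᵥ phaseState γ C ψ := by
  ext z
  rw [qaoaStep_apply]; rfl

/-- `Z_j` is moved through the mixer, whose unitary then cancels in the inner product. The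
expectation no longer involves a matrix exponential. -/
lemma expect_spin {n : ℕ} (γ β : ℝ) (C : Spins n → ℝ) (ψ : Spins n → ℂ) (j : Fin n) :
    ((∑ z, ‖qaoaStep γ β C ψ z‖ ^ 2 * sgn (z j) : ℝ) : ℂ) =
      star (phaseState γ C ψ) ⬝ᵥ (heisenbergZ β j *ᵥ phaseState γ C ψ) := by
  rw [← star_dotProduct_isometry (exp_isUnitary (mixer_isHermitian n) β), Matrix.mulVec_mulVec,
    ← pauliZ_mul_exp_mixer, ← Matrix.mulVec_mulVec, ← qaoaStep_eq]
  simp only [dotProduct, pauliZ_mulVec, Pi.star_apply, Complex.ofReal_sum, Complex.ofReal_mul]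
  refine Finset.sum_congr rfl fun z _ => ?_
  rw [RCLike.star_def, mul_left_comm, Complex.conj_mul', mul_comm]
  push_cast; rfl

lemma expect_spin_pair {n : ℕ} (γ β : ℝ) (C : Spins n → ℝ) (ψ : Spins n → ℂ) (j l : Fin n) :
    ((∑ z, ‖qaoaStep γ β C ψ z‖ ^ 2 * (sgn (z j) * sgn (z l)) : ℝ) : ℂ) =
      star (phaseState γ C ψ) ⬝ᵥ
        (heisenbergZ β j *ᵥ (heisenbergZ β l *ᵥ phaseState γ C ψ)) := by
  rw [← star_dotProduct_isometry (exp_isUnitary (mixer_isHermitian n) β), Matrix.mulVec_mulVec,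
    ← pauliZ_mul_exp_mixer, ← Matrix.mulVec_mulVec (heisenbergZ β l *ᵥ _),
    Matrix.mulVec_mulVec _ _ (heisenbergZ β l), ← pauliZ_mul_exp_mixer, ← Matrix.mulVec_mulVec,
    ← qaoaStep_eq]
  simp only [dotProduct, pauliZ_mulVec, Pi.star_apply, Complex.ofReal_sum, Complex.ofReal_mul]
  refine Finset.sum_congr rfl fun z _ => ?_
  rw [RCLike.star_def, Complex.ofReal_pow, ← Complex.conj_mul']
  ring

/-! ### Average over the noise tensor -/

lemma sum_tensorPow_mul {n : ℕ} (q : ℕ) (u z : Spins n) :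
    ∑ J, tensorPow q u J * tensorPow q z J = (∑ i, sgn (u i) * sgn (z i)) ^ q := by
  simp only [tensorPow, ← Finset.prod_mul_distrib, Fintype.sum_pow]

lemma cost_spikedTensor {n q : ℕ} (lam : ℝ) (u : Spins n) (W : Tensor n q) (z : Spins n) :
    cost (spikedTensor lam u W) z =
      lam / ((n : ℝ) ^ ((q : ℝ) / 2) * (n : ℝ) ^ (((q : ℝ) - 2) / 2)) *
          (∑ i, sgn (u i) * sgn (z i)) ^ q +
        ∑ J, 1 / (√(n : ℝ) * (n : ℝ) ^ (((q : ℝ) - 2) / 2)) * tensorPow q z J * W J := by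
  rw [← sum_tensorPow_mul, cost, Finset.mul_sum, ← Finset.sum_add_distrib, Finset.sum_div]
  refine Finset.sum_congr rfl fun J _ => ?_
  simp only [spikedTensor, div_eq_mul_inv, mul_inv]
  ring

lemma rpow_signal {n q : ℕ} (hn : 0 < n) (hq : 1 ≤ q) :
    (n : ℝ) ^ ((q : ℝ) / 2) * (n : ℝ) ^ (((q : ℝ) - 2) / 2) = (n : ℝ) ^ (q - 1) := by
  rw [← Real.rpow_add (by positivity), ← Real.rpow_natCast, Nat.cast_sub hq]
  congr 1
  push_cast; ring

lemma rpow_noise {n q : ℕ} (hn : 0 < n) (hq : 1 ≤ q) :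
    (√(n : ℝ) * (n : ℝ) ^ (((q : ℝ) - 2) / 2)) ^ 2 = (n : ℝ) ^ (q - 1) := by
  rw [mul_pow, Real.sq_sqrt (by positivity), ← Real.rpow_natCast, ← Real.rpow_mul (by positivity),
    ← Real.rpow_natCast _ (q - 1), Nat.cast_sub hq]
  nth_rewrite 1 [← Real.rpow_one (n : ℝ)]
  rw [← Real.rpow_add (by positivity)]
  congr 1
  push_cast; ring

lemma integral_exp_gaussian {ι : Type*} [Fintype ι] (t : ι → ℝ) :
    ∫ W : ι → ℝ, Complex.exp (Complex.I * ((∑ J, t J * W J : ℝ) : ℂ))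
        ∂(Measure.pi fun _ => gaussianReal 0 1) =
      Complex.exp ((-(∑ J, t J ^ 2) / 2 : ℝ) : ℂ) := by
  have h : ∀ W : ι → ℝ, Complex.exp (Complex.I * ((∑ J, t J * W J : ℝ) : ℂ)) =
      ∏ J, Complex.exp (t J * W J * Complex.I) := by
    intro W
    rw [← Complex.exp_sum, ← Finset.sum_mul, mul_comm]
    push_cast; rfl
  simp only [h]
  rw [integral_fintype_prod_eq_prod (𝕜 := ℂ)
    (fun J (w : ℝ) => Complex.exp (t J * w * Complex.I))]
  have h2 : ∀ J, ∫ w : ℝ, Complex.exp (t J * w * Complex.I) ∂(gaussianReal 0 1) =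
      Complex.exp (-(t J : ℂ) ^ 2 / 2) := by
    intro J
    rw [← charFun_apply_real, charFun_gaussianReal]
    congr 1
    push_cast; ring
  rw [Finset.prod_congr rfl fun J _ => h2 J, ← Complex.exp_sum]
  congr 1
  push_cast
  rw [← Finset.sum_div, Finset.sum_neg_distrib]

/-- The noise part of the phase difference is linear in `W`, with coefficient vector proportional to
`z^{⊗q} - w^{⊗q}`. Its characteristic function sees only the squared norm of that vector, hence only
the overlap of `z` and `w`. -/
lemma integral_phase {n q : ℕ} (hn : 0 < n) (hq : 1 ≤ q) (γ lam : ℝ) (u z w : Spins n) :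
    ∫ W : Tensor n q, Complex.exp (Complex.I * ((γ * (cost (spikedTensor lam u W) z -
        cost (spikedTensor lam u W) w) : ℝ) : ℂ)) ∂(Measure.pi fun _ => gaussianReal 0 1) =
      Complex.exp ((-(γ ^ 2 * ((n : ℝ) ^ q - (∑ i, sgn (z i) * sgn (w i)) ^ q) /
          (n : ℝ) ^ (q - 1)) : ℝ) : ℂ) *
        Complex.exp (Complex.I * ((γ * (lam / (n : ℝ) ^ (q - 1)) *
          ((∑ i, sgn (u i) * sgn (z i)) ^ q - (∑ i, sgn (u i) * sgn (w i)) ^ q) : ℝ) : ℂ)) := by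
  set d : ℝ := √(n : ℝ) * (n : ℝ) ^ (((q : ℝ) - 2) / 2) with hd
  set t : (Fin q → Fin n) → ℝ := fun J => γ / d * (tensorPow q z J - tensorPow q w J) with ht
  have h1 : ∀ W : Tensor n q, Complex.exp (Complex.I * ((γ * (cost (spikedTensor lam u W) z -
      cost (spikedTensor lam u W) w) : ℝ) : ℂ)) =
      Complex.exp (Complex.I * ((γ * (lam / (n : ℝ) ^ (q - 1)) *
          ((∑ i, sgn (u i) * sgn (z i)) ^ q - (∑ i, sgn (u i) * sgn (w i)) ^ q) : ℝ) : ℂ)) *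
        Complex.exp (Complex.I * ((∑ J, t J * W J : ℝ) : ℂ)) := by
    intro W
    rw [← Complex.exp_add, ← mul_add, ← Complex.ofReal_add, cost_spikedTensor, cost_spikedTensor,
      rpow_signal hn hq, ← hd]
    have h2 : ∑ J, t J * W J = γ * (∑ J, 1 / d * tensorPow q z J * W J -
        ∑ J, 1 / d * tensorPow q w J * W J) := by
      rw [← Finset.sum_sub_distrib, Finset.mul_sum]
      refine Finset.sum_congr rfl fun J _ => ?_
      simp only [ht]; ring
    rw [h2]
    congr 4
    ring
  simp only [h1]
  rw [integral_const_mul, integral_exp_gaussian, mul_comm]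
  congr 4
  have h3 : ∑ J, t J ^ 2 = γ ^ 2 / d ^ 2 * (∑ J, tensorPow q z J * tensorPow q z J +
      ∑ J, tensorPow q w J * tensorPow q w J - 2 * ∑ J, tensorPow q z J * tensorPow q w J) := by
    rw [Finset.mul_sum, ← Finset.sum_add_distrib, ← Finset.sum_sub_distrib, Finset.mul_sum]
    refine Finset.sum_congr rfl fun J _ => ?_
    simp only [ht]; ring
  rw [h3, sum_tensorPow_mul, sum_tensorPow_mul, sum_tensorPow_mul, hd, rpow_noise hn hq]
  simp only [sgn_mul_self, Finset.sum_const, Finset.card_univ, Fintype.card_fin, nsmul_eq_mul,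
    mul_one]
  ring

/-! ### Average over the angles -/

/-- The amplitude of a single qubit at `s * u_j`. -/
noncomputable def amp (θ : ℝ) (s : ℤˣ) : ℝ := if s = 1 then Real.cos θ else Real.sin θ

lemma abs_amp_le (θ : ℝ) (s : ℤˣ) : |amp θ s| ≤ 1 := by
  unfold amp
  split_ifs
  · exact Real.abs_cos_le_one θ
  · exact Real.abs_sin_le_one θ

lemma biasedState_mul {n : ℕ} (u : Spins n) (θ : Fin n → ℝ) (x : Spins n) :
    biasedState u θ (x * u) = ((∏ j, amp (θ j) (x j) : ℝ) : ℂ) := by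
  rw [Complex.ofReal_prod, biasedState]
  refine Finset.prod_congr rfl fun j _ => ?_
  rcases Int.units_eq_one_or (u j) with h | h <;> rcases Int.units_eq_one_or (x j) with h' | h' <;>
    simp [amp, ket, h, h']

lemma integral_angleLaw {p : ℝ} (hp : p ∈ Set.Icc (0 : ℝ) 1) (δ : ℝ) (f : ℝ → ℝ) :
    ∫ θ, f θ ∂(angleLaw p δ) = (1 - p) * f (Real.pi / 4) + p * f (Real.pi / 4 - δ) := by
  have hi : ∀ a b : ℝ, Integrable f (ENNReal.ofReal a • Measure.dirac b) := fun a b =>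
    (integrable_dirac enorm_lt_top).smul_measure ENNReal.ofReal_ne_top
  rw [angleLaw, integral_add_measure (hi _ _) (hi _ _), integral_smul_measure,
    integral_smul_measure, integral_dirac, integral_dirac,
    ENNReal.toReal_ofReal (sub_nonneg.2 hp.2), ENNReal.toReal_ofReal hp.1]
  rfl

/-- The squared amplitude is `(1 ± cos 2θ)/2`, and `cos 2θ` is `0` at `π/4` and `sin 2δ` at `π/4 -
δ`. -/
lemma integral_amp_sq {p : ℝ} (hp : p ∈ Set.Icc (0 : ℝ) 1) (δ : ℝ) (s : ℤˣ) :
    ∫ θ, amp θ s * amp θ s ∂(angleLaw p δ) = (1 + sgn s * (p * Real.sin (2 * δ))) / 2 := by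
  rw [integral_angleLaw hp]
  have h1 : Real.cos (2 * (Real.pi / 4 - δ)) = Real.sin (2 * δ) := by
    rw [← Real.cos_pi_div_two_sub]; ring_nf
  have h2 : Real.cos (2 * (Real.pi / 4)) = 0 := by
    rw [← Real.cos_pi_div_two]; ring_nf
  rw [← h1]
  rw [Real.cos_two_mul] at h1 h2 ⊢
  have h3 := Real.sin_sq_add_cos_sq (Real.pi / 4)
  have h4 := Real.sin_sq_add_cos_sq (Real.pi / 4 - δ)
  rcases Int.units_eq_one_or s with h | h
  · simp only [h, amp, if_true, sgn_one]
    linear_combination (1 - p) / 2 * h2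
  · simp only [h, amp, sgn_neg, sgn_one, show ((-1 : ℤˣ) = 1) = False by decide, if_false]
    linear_combination (1 - p) * h3 + p * h4 - (1 - p) / 2 * h2

/-- The product is `(sin 2θ)/2` for either sign of `s`: a flipped qubit becomes a fair spin, up to a
constant factor. -/
lemma integral_amp_mul_neg {p : ℝ} (hp : p ∈ Set.Icc (0 : ℝ) 1) (δ : ℝ) (s : ℤˣ) :
    ∫ θ, amp θ s * amp θ (-s) ∂(angleLaw p δ) = (1 - p + p * Real.cos (2 * δ)) * (1 / 2) := by
  rw [integral_angleLaw hp]
  have h1 : Real.sin (2 * (Real.pi / 4 - δ)) = Real.cos (2 * δ) := by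
    rw [← Real.sin_pi_div_two_sub]; ring_nf
  have h2 : Real.sin (2 * (Real.pi / 4)) = 1 := by
    rw [← Real.sin_pi_div_two]; ring_nf
  rw [← h1]
  rw [Real.sin_two_mul] at h1 h2 ⊢
  rcases Int.units_eq_one_or s with h | h <;>
  · simp only [h, amp, if_true, show ((-1 : ℤˣ) = 1) = False by decide, if_false, neg_neg]
    linear_combination (1 - p) / 2 * h2

/-- Single-spin weights: uniform on `A`, with mean `μ` off `A`. -/
noncomputable def spinWeight {n : ℕ} (μ : ℝ) (A : Finset (Fin n)) (i : Fin n) (s : ℤˣ) : ℝ :=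
  if i ∈ A then 1 / 2 else (1 + sgn s * μ) / 2

lemma integral_amp_flip {n : ℕ} {p : ℝ} (hp : p ∈ Set.Icc (0 : ℝ) 1) (δ : ℝ)
    (A : Finset (Fin n)) (x : Spins n) :
    ∫ θ : Fin n → ℝ, (∏ j, amp (θ j) (x j)) * ∏ j, amp (θ j) (flip A x j)
        ∂(Measure.pi fun _ => angleLaw p δ) =
      (1 - p + p * Real.cos (2 * δ)) ^ A.card *
        ∏ i, spinWeight (p * Real.sin (2 * δ)) A i (x i) := by
  simp only [← Finset.prod_mul_distrib]
  rw [integral_fintype_prod_eq_prod (𝕜 := ℝ)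
    (fun j (θ : ℝ) => amp θ (x j) * amp θ (flip A x j))]
  have h : ∀ j, ∫ θ, amp θ (x j) * amp θ (flip A x j) ∂(angleLaw p δ) =
      (if j ∈ A then (1 - p + p * Real.cos (2 * δ)) else 1) *
        spinWeight (p * Real.sin (2 * δ)) A j (x j) := by
    intro j
    by_cases hj : j ∈ A
    · simp only [flip_apply, hj, if_true, spinWeight]
      exact integral_amp_mul_neg hp δ _
    · simp only [flip_apply, hj, if_false, spinWeight, one_mul]
      exact integral_amp_sq hp δ _
  rw [Finset.prod_congr rfl fun j _ => h j, Finset.prod_mul_distrib]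
  congr 1
  rw [Finset.prod_ite_mem, Finset.univ_inter, Finset.prod_const]

/-! ### Averaged correlations of amplitudes -/

/-- Law of the angles and the noise tensor. -/
noncomputable def noiseLaw (n q : ℕ) (p δ : ℝ) : Measure ((Fin n → ℝ) × Tensor n q) :=
  (Measure.pi fun _ : Fin n => angleLaw p δ).prod
    (Measure.pi fun _ : Fin q → Fin n => gaussianReal 0 1)

lemma isProbabilityMeasure_noiseLaw (n q : ℕ) {p : ℝ} (hp : p ∈ Set.Icc (0 : ℝ) 1) (δ : ℝ) :
    IsProbabilityMeasure (noiseLaw n q p δ) := by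
  have := isProbabilityMeasure_angleLaw hp δ
  unfold noiseLaw
  infer_instance

/-- The state before the mixer is applied. -/
noncomputable def preState {n q : ℕ} (γ lam : ℝ) (u : Spins n) (ω : (Fin n → ℝ) × Tensor n q) :
    Spins n → ℂ :=
  phaseState γ (cost (spikedTensor lam u ω.2)) (biasedState u ω.1)

/-- The product of amplitudes `⟨φ|x⟩⟨flip A x|φ⟩`, relative to the signal `u`. -/
noncomputable def coherence {n q : ℕ} (γ lam : ℝ) (u : Spins n) (A : Finset (Fin n)) (x : Spins n)
    (ω : (Fin n → ℝ) × Tensor n q) : ℂ :=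
  star (preState γ lam u ω (x * u)) * preState γ lam u ω (flip A x * u)

lemma coherence_eq {n q : ℕ} (γ lam : ℝ) (u : Spins n) (A : Finset (Fin n)) (x : Spins n)
    (ω : (Fin n → ℝ) × Tensor n q) :
    coherence γ lam u A x ω =
      (((∏ j, amp (ω.1 j) (x j)) * ∏ j, amp (ω.1 j) (flip A x j) : ℝ) : ℂ) *
        Complex.exp (Complex.I * ((γ * (cost (spikedTensor lam u ω.2) (x * u) -
          cost (spikedTensor lam u ω.2) (flip A x * u)) : ℝ) : ℂ)) := by
  have h : ∀ a b : ℝ, Complex.exp (Complex.I * ((γ * (a - b) : ℝ) : ℂ)) =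
      star (Complex.exp (-(Complex.I * (γ : ℂ)) * (a : ℂ))) *
        Complex.exp (-(Complex.I * (γ : ℂ)) * (b : ℂ)) := by
    intro a b
    rw [RCLike.star_def, ← Complex.exp_conj, ← Complex.exp_add]
    congr 1
    simp; ring
  rw [h]
  simp only [coherence, preState, phaseState, biasedState_mul, star_mul', Complex.ofReal_mul,
    RCLike.star_def, Complex.conj_ofReal]
  ring

/-- The phase difference between `x` and `flip A x` produced by the signal. -/
noncomputable def signalPhase {n : ℕ} (q : ℕ) (γ lam : ℝ) (A : Finset (Fin n)) (x : Spins n) : ℝ :=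
  γ * (lam / (n : ℝ) ^ (q - 1)) *
    ((∑ i, sgn (x i)) ^ q - (∑ i, sgn (x i) - 2 * ∑ i ∈ A, sgn (x i)) ^ q)

/-- The damping exponent for `a` flipped spins. -/
noncomputable def damping (n q a : ℕ) (γ : ℝ) : ℝ :=
  γ ^ 2 * ((n : ℝ) ^ q - ((n : ℝ) - 2 * a) ^ q) / (n : ℝ) ^ (q - 1)

lemma sum_mul_flip {n : ℕ} (A : Finset (Fin n)) (f : Fin n → ℝ) :
    ∑ i, (if i ∈ A then -f i else f i) = ∑ i, f i - 2 * ∑ i ∈ A, f i := by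
  have h : ∀ i, (if i ∈ A then -f i else f i) = f i - if i ∈ A then 2 * f i else 0 := by
    intro i; split_ifs <;> ring
  simp only [h, Finset.sum_sub_distrib, Finset.sum_ite_mem, Finset.univ_inter, Finset.mul_sum]

/-- The moduli depend only on the angles and the phase only on `W`, so the integral factorizes. In
the coordinates `x = z * u`, overlaps with the signal are magnetizations and `u` drops out. -/
lemma integral_coherence {n q : ℕ} (hn : 0 < n) (hq : 1 ≤ q) {p : ℝ} (hp : p ∈ Set.Icc (0 : ℝ) 1)
    (γ δ lam : ℝ) (u : Spins n) (A : Finset (Fin n)) (x : Spins n) :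
    ∫ ω, coherence γ lam u A x ω ∂(noiseLaw n q p δ) =
      ((1 - p + p * Real.cos (2 * δ)) ^ A.card * Real.exp (-damping n q A.card γ) : ℝ) *
        ((∏ i, spinWeight (p * Real.sin (2 * δ)) A i (x i) : ℝ) *
          Complex.exp (Complex.I * (signalPhase q γ lam A x : ℂ))) := by
  simp only [coherence_eq, noiseLaw]
  rw [integral_prod_mul (L := ℂ)
    (fun θ : Fin n → ℝ => (((∏ j, amp (θ j) (x j)) * ∏ j, amp (θ j) (flip A x j) : ℝ) : ℂ))
    (fun W : Tensor n q => Complex.exp (Complex.I * ((γ * (cost (spikedTensor lam u W) (x * u) -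
          cost (spikedTensor lam u W) (flip A x * u)) : ℝ) : ℂ))), integral_complex_ofReal,
    integral_amp_flip hp, integral_phase hn hq]
  have h1 : ∀ i, sgn (u i) * sgn ((x * u) i) = sgn (x i) := by
    intro i
    rw [Pi.mul_apply, sgn_mul, mul_left_comm, sgn_mul_self, mul_one]
  have h2 : ∀ i, sgn (u i) * sgn ((flip A x * u) i) =
      if i ∈ A then -sgn (x i) else sgn (x i) := by
    intro i
    rw [Pi.mul_apply, sgn_mul, mul_left_comm, sgn_mul_self, mul_one, flip_apply]
    split_ifs <;> simp
  have h3 : ∀ i, sgn ((x * u) i) * sgn ((flip A x * u) i) = if i ∈ A then -1 else 1 := by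
    intro i
    rw [Pi.mul_apply, Pi.mul_apply, sgn_mul, sgn_mul, mul_mul_mul_comm, sgn_mul_self, mul_one,
      flip_apply]
    split_ifs <;> simp
  simp only [h1, h2, h3, sum_mul_flip A fun i => sgn (x i), sum_mul_flip A fun _ => (1 : ℝ),
    signalPhase, damping]
  simp only [Finset.sum_const, Finset.card_univ, Fintype.card_fin, nsmul_eq_mul, mul_one]
  push_cast
  ring

lemma norm_coherence_le {n q : ℕ} (γ lam : ℝ) (u : Spins n) (A : Finset (Fin n)) (x : Spins n)
    (ω : (Fin n → ℝ) × Tensor n q) : ‖coherence γ lam u A x ω‖ ≤ 1 := by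
  have h : ∀ y : Spins n, |∏ j, amp (ω.1 j) (y j)| ≤ 1 := fun y => by
    rw [Finset.abs_prod]
    exact Finset.prod_le_one (fun _ _ => abs_nonneg _) fun _ _ => abs_amp_le _ _
  rw [coherence_eq, norm_mul, Complex.norm_exp_I_mul_ofReal, mul_one, Complex.norm_real,
    Real.norm_eq_abs, abs_mul]
  exact mul_le_one₀ (h _) (abs_nonneg _) (h _)

lemma integrable_coherence {n q : ℕ} {p : ℝ} (hp : p ∈ Set.Icc (0 : ℝ) 1)
    (γ δ lam : ℝ) (u : Spins n) (A : Finset (Fin n)) (x : Spins n) :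
    Integrable (fun ω => coherence γ lam u A x ω) (noiseLaw n q p δ) := by
  have := isProbabilityMeasure_noiseLaw n q hp δ
  refine Integrable.of_bound (Measurable.aestronglyMeasurable ?_) 1
    (Eventually.of_forall fun ω => norm_coherence_le γ lam u A x ω)
  have hm : ∀ s, Measurable fun θ : ℝ => amp θ s := by
    intro s
    unfold amp
    split_ifs
    · exact Real.measurable_cos
    · exact Real.measurable_sin
  simp only [coherence_eq, cost_spikedTensor]
  fun_prop

/-! ### Averages over independent spins -/

lemma sum_prod_weight {R : Type*} [CommSemiring R] {n : ℕ} {w : Fin n → ℤˣ → R}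
    (hw : ∀ k, w k 1 + w k (-1) = 1) (S : Finset (Fin n)) (g : Fin n → ℤˣ → R) :
    ∑ x : Spins n, (∏ k, w k (x k)) * ∏ k ∈ S, g k (x k) =
      ∏ k ∈ S, (w k 1 * g k 1 + w k (-1) * g k (-1)) := by
  have h : ∀ x : Spins n, (∏ k, w k (x k)) * ∏ k ∈ S, g k (x k) =
      ∏ k, w k (x k) * if k ∈ S then g k (x k) else 1 := by
    intro x
    rw [Finset.prod_mul_distrib, Finset.prod_ite_mem, Finset.univ_inter]
  simp only [h]
  rw [← Fintype.prod_sum fun (k : Fin n) (s : ℤˣ) => w k s * if k ∈ S then g k s else 1,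
    ← Finset.univ_inter S, ← Finset.prod_ite_mem]
  refine Finset.prod_congr rfl fun k _ => ?_
  rw [sum_units, Finset.univ_inter]
  split_ifs
  · rfl
  · rw [mul_one, mul_one, hw]

lemma spinWeight_nonneg {n : ℕ} {μ : ℝ} (hμ : |μ| ≤ 1) (A : Finset (Fin n)) (i : Fin n)
    (s : ℤˣ) : 0 ≤ spinWeight μ A i s := by
  have := abs_le.1 hμ
  unfold spinWeight
  split_ifs
  · norm_num
  · rcases Int.units_eq_one_or s with h | h <;> simp [h] <;> linarith

lemma spinWeight_add {n : ℕ} (μ : ℝ) (A : Finset (Fin n)) (i : Fin n) :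
    spinWeight μ A i 1 + spinWeight μ A i (-1) = 1 := by
  unfold spinWeight
  split_ifs
  · norm_num
  · simp; ring

lemma sum_prod_spinWeight {n : ℕ} (μ : ℝ) (A : Finset (Fin n)) :
    ∑ x : Spins n, ∏ i, spinWeight μ A i (x i) = 1 := by
  simpa using sum_prod_weight (spinWeight_add μ A) ∅ fun _ _ => 1

/-- A linear phase factorizes over sites. A fair spin in `A` has `E[s e^{isy}] = i sin y`; a spin in
`B \ A` carries no phase and contributes its mean. -/
lemma sum_spinWeight_mul_exp {n : ℕ} (μ y : ℝ) {A B : Finset (Fin n)} (hAB : A ⊆ B) :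
    ∑ x : Spins n, ((∏ i, spinWeight μ A i (x i) : ℝ) : ℂ) * ((∏ i ∈ B, sgn (x i) : ℝ) *
        Complex.exp (Complex.I * ((∑ i ∈ A, sgn (x i)) * y : ℝ))) =
      (Complex.I * Real.sin y) ^ A.card * (μ : ℂ) ^ (B \ A).card := by
  have h : ∀ x : Spins n, ((∏ i, spinWeight μ A i (x i) : ℝ) : ℂ) * ((∏ i ∈ B, sgn (x i) : ℝ) *
        Complex.exp (Complex.I * ((∑ i ∈ A, sgn (x i)) * y : ℝ))) =
      (∏ i, (spinWeight μ A i (x i) : ℂ)) * ∏ i ∈ B, ((sgn (x i) : ℂ) *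
        if i ∈ A then Complex.exp (Complex.I * (sgn (x i) * y)) else 1) := by
    intro x
    rw [Finset.prod_mul_distrib, Finset.prod_ite_mem, Finset.inter_eq_right.2 hAB,
      ← Complex.exp_sum, ← Finset.mul_sum, ← Finset.sum_mul]
    push_cast; rfl
  simp only [h]
  rw [sum_prod_weight (w := fun i s => (spinWeight μ A i s : ℂ))
    (fun i => by exact_mod_cast spinWeight_add μ A i) B
    (fun i s => (sgn s : ℂ) * if i ∈ A then Complex.exp (Complex.I * (sgn s * y)) else 1),
    ← Finset.prod_sdiff hAB, mul_comm]
  congr 1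
  · refine Finset.prod_eq_pow_card fun i hi => ?_
    simp only [spinWeight, hi, if_true, sgn_one, sgn_neg]
    rw [Complex.ofReal_sin, Complex.sin]
    push_cast
    have h1 : Complex.I * (1 * (y : ℂ)) = y * Complex.I := by ring
    have h2 : Complex.I * (-1 * (y : ℂ)) = -y * Complex.I := by ring
    rw [h1, h2]
    linear_combination (Complex.exp (y * Complex.I) - Complex.exp (-y * Complex.I)) / 2 *
      Complex.I_mul_I
  · refine Finset.prod_eq_pow_card fun i hi => ?_
    have hi' := (Finset.mem_sdiff.1 hi).2
    simp only [spinWeight, hi', if_false, sgn_one, sgn_neg]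
    push_cast; ring

/-- Variance bound: each diagonal term is at most `4`. Spins off `A` are centred, so a cross term
survives only when both sites lie in `A`; it then equals `μ² ≤ 1`, and there are at most `|A|² ≤ 4`
such pairs. -/
lemma sum_spinWeight_mul_sq_le {n : ℕ} {μ : ℝ} (hμ : |μ| ≤ 1) {A : Finset (Fin n)}
    (hA : A.card ≤ 2) :
    ∑ x : Spins n, (∏ i, spinWeight μ A i (x i)) * (∑ i, (sgn (x i) - μ)) ^ 2 ≤ 4 * n + 4 := by
  have hμ' := abs_le.1 hμ
  have hp : ∀ x : Spins n, 0 ≤ ∏ i, spinWeight μ A i (x i) := fun x =>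
    Finset.prod_nonneg fun i _ => spinWeight_nonneg hμ A i (x i)
  have h1 : ∀ i j, ∑ x : Spins n, (∏ k, spinWeight μ A k (x k)) *
      ((sgn (x i) - μ) * (sgn (x j) - μ)) ≤
      (if i = j then 4 else 0) + (if i ∈ A then 1 else 0) * (if j ∈ A then 1 else 0) := by
    intro i j
    by_cases hij : i = j
    · subst hij
      refine (Finset.sum_le_sum fun x _ => mul_le_mul_of_nonneg_left
        (?_ : _ ≤ (4 : ℝ)) (hp x)).trans ?_
      · rcases Int.units_eq_one_or (x i) with h | h <;> simp only [h, sgn_one, sgn_neg] <;>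
          nlinarith
      · rw [← Finset.sum_mul, sum_prod_spinWeight, if_pos rfl]
        split_ifs <;> norm_num
    · have h2 : ∀ x : Spins n, (sgn (x i) - μ) * (sgn (x j) - μ) =
          ∏ k ∈ {i, j}, (sgn (x k) - μ) := fun x => by rw [Finset.prod_pair hij]
      simp only [h2]
      rw [sum_prod_weight (spinWeight_add μ A) {i, j} fun _ s => sgn s - μ, Finset.prod_pair hij]
      have h3 : ∀ k, spinWeight μ A k 1 * (sgn 1 - μ) + spinWeight μ A k (-1) * (sgn (-1) - μ) =
          -μ * if k ∈ A then 1 else 0 := by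
        intro k
        unfold spinWeight
        split_ifs <;> simp <;> ring
      rw [h3, h3, if_neg hij, zero_add]
      split_ifs <;> nlinarith
  have h4 : ∀ x : Spins n, (∏ i, spinWeight μ A i (x i)) * (∑ i, (sgn (x i) - μ)) ^ 2 =
      ∑ i, ∑ j, (∏ k, spinWeight μ A k (x k)) * ((sgn (x i) - μ) * (sgn (x j) - μ)) := by
    intro x
    rw [pow_two, Finset.sum_mul_sum, Finset.mul_sum]
    simp only [Finset.mul_sum]
  simp only [h4]
  rw [Finset.sum_comm]
  simp_rw [Finset.sum_comm (s := (Finset.univ : Finset (Spins n)))]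
  refine (Finset.sum_le_sum fun i _ => Finset.sum_le_sum fun j _ => h1 i j).trans ?_
  have hA' : (A.card : ℝ) ≤ 2 := by exact_mod_cast hA
  simp only [Finset.sum_add_distrib, ← Finset.sum_mul_sum, Finset.sum_ite_eq, Finset.mem_univ,
    if_true, Finset.sum_ite_mem, Finset.univ_inter, Finset.sum_const, Finset.card_univ,
    Fintype.card_fin, nsmul_eq_mul, mul_one]
  nlinarith [(Nat.cast_nonneg A.card : (0 : ℝ) ≤ A.card)]

/-! ### The phase produced by the signal -/

/-- The signal phase per unit of flipped magnetization, at rescaled magnetizations `t` and `s`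
before and after the flip. -/
noncomputable def phaseRate (q : ℕ) (γ L t s : ℝ) : ℝ :=
  2 * γ * L * ∑ i ∈ Finset.range q, t ^ i * s ^ (q - 1 - i)

lemma phaseRate_self (q : ℕ) (γ L t : ℝ) : phaseRate q γ L t t = 2 * q * L * γ * t ^ (q - 1) := by
  have h : ∀ i ∈ Finset.range q, t ^ i * t ^ (q - 1 - i) = t ^ (q - 1) := by
    intro i hi
    rw [← pow_add]
    congr 1
    have := Finset.mem_range.1 hi
    omega
  rw [phaseRate, Finset.sum_congr rfl h]
  simp; ring

/-- This is the factorization of `a^q - b^q` with `a - b = 2σ`. The powers of `n` match because `q -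
1 = (1 - c)(q - 1) + c(q - 1)`, which is what fixes the scaling of `lam`. -/
lemma signalPhase_eq {n q : ℕ} (hn : 0 < n) (hq : 1 ≤ q) (γ lam c : ℝ) (A : Finset (Fin n))
    (x : Spins n) :
    signalPhase q γ lam A x = (∑ i ∈ A, sgn (x i)) *
      phaseRate q γ (lam / (n : ℝ) ^ ((1 - c) * ((q : ℝ) - 1))) ((∑ i, sgn (x i)) / (n : ℝ) ^ c)
        ((∑ i, sgn (x i) - 2 * ∑ i ∈ A, sgn (x i)) / (n : ℝ) ^ c) := by
  rw [signalPhase, phaseRate]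
  generalize ∑ i, sgn (x i) = m
  generalize ∑ i ∈ A, sgn (x i) = σ
  have hn' : (0 : ℝ) < n := by exact_mod_cast hn
  have hsum : ∑ i ∈ Finset.range q, (m / (n : ℝ) ^ c) ^ i *
      ((m - 2 * σ) / (n : ℝ) ^ c) ^ (q - 1 - i) =
      (∑ i ∈ Finset.range q, m ^ i * (m - 2 * σ) ^ (q - 1 - i)) / ((n : ℝ) ^ c) ^ (q - 1) := by
    rw [Finset.sum_div]
    refine Finset.sum_congr rfl fun i hi => ?_
    rw [div_pow, div_pow, div_mul_div_comm, ← pow_add]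
    congr 3
    have := Finset.mem_range.1 hi
    omega
  have hpow : (n : ℝ) ^ (q - 1) =
      (n : ℝ) ^ ((1 - c) * ((q : ℝ) - 1)) * ((n : ℝ) ^ c) ^ (q - 1) := by
    rw [← Real.rpow_natCast _ (q - 1), ← Real.rpow_natCast _ (q - 1), ← Real.rpow_mul hn'.le,
      ← Real.rpow_add hn', Nat.cast_sub hq]
    congr 1
    push_cast; ring
  rw [hsum, hpow, ← geom_sum₂_mul]
  have h1 : (n : ℝ) ^ ((1 - c) * ((q : ℝ) - 1)) ≠ 0 := (Real.rpow_pos_of_pos hn' _).ne'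
  have h2 : ((n : ℝ) ^ c) ^ (q - 1) ≠ 0 := (pow_pos (Real.rpow_pos_of_pos hn' _) _).ne'
  field_simp
  ring

/-- Uniform continuity on a compact box. Uniformity in the base point is needed because `k n / n^c`
is only bounded and need not converge. Capping `τ` at `1` keeps perturbed points in the box of
half-width `K + 1`. -/
lemma exists_phaseRate_close (q : ℕ) (γ K : ℝ) {ε : ℝ} (hε : 0 < ε) :
    ∃ τ > 0, ∀ L₀ t₀ L t s : ℝ, |L₀| ≤ K → |t₀| ≤ K → |L - L₀| ≤ τ → |t - t₀| ≤ τ → |s - t₀| ≤ τ →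
      |phaseRate q γ L t s - phaseRate q γ L₀ t₀ t₀| ≤ ε := by
  set I := Set.Icc (-(K + 1)) (K + 1)
  have hcomp : IsCompact (I ×ˢ I ×ˢ I) := isCompact_Icc.prod (isCompact_Icc.prod isCompact_Icc)
  have hcont : Continuous fun v : ℝ × ℝ × ℝ => phaseRate q γ v.1 v.2.1 v.2.2 := by
    unfold phaseRate
    fun_prop
  obtain ⟨τ, hτ, h⟩ := Metric.uniformContinuousOn_iff_le.1
    (hcomp.uniformContinuousOn_of_continuous hcont.continuousOn) ε hε
  refine ⟨min τ 1, lt_min hτ one_pos, fun L₀ t₀ L t s hL₀ ht₀ hL ht hs => ?_⟩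
  have hmem : ∀ a b : ℝ, |b| ≤ K → |a - b| ≤ min τ 1 → a ∈ I := fun a b hb hab => by
    have h1 := abs_le.1 hb
    have h2 := abs_le.1 (hab.trans (min_le_right _ _))
    constructor <;> linarith
  have hmem' : ∀ b : ℝ, |b| ≤ K → b ∈ I := fun b hb =>
    hmem b b hb (by simpa using (lt_min hτ one_pos).le)
  have h1 := h (L, t, s) ⟨hmem _ _ hL₀ hL, hmem _ _ ht₀ ht, hmem _ _ ht₀ hs⟩ (L₀, t₀, t₀)
    ⟨hmem' _ hL₀, hmem' _ ht₀, hmem' _ ht₀⟩ (by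
      simp only [Prod.dist_eq, Real.dist_eq]
      exact max_le (hL.trans (min_le_left _ _))
        (max_le (ht.trans (min_le_left _ _)) (hs.trans (min_le_left _ _))))
  simpa [Real.dist_eq] using h1

lemma norm_exp_I_sub_le (a b : ℝ) :
    ‖Complex.exp (Complex.I * a) - Complex.exp (Complex.I * b)‖ ≤ |a - b| := by
  have h : Complex.exp (Complex.I * a) - Complex.exp (Complex.I * b) =
      Complex.exp (Complex.I * b) * (Complex.exp (Complex.I * ((a - b : ℝ) : ℂ)) - 1) := by
    rw [mul_sub, ← Complex.exp_add, mul_one]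
    congr 2
    push_cast; ring
  rw [h, norm_mul, Complex.norm_exp_I_mul_ofReal, one_mul]
  exact Real.norm_exp_I_mul_ofReal_sub_one_le

lemma norm_exp_I_sub_le_two (a b : ℝ) :
    ‖Complex.exp (Complex.I * a) - Complex.exp (Complex.I * b)‖ ≤ 2 := by
  refine (norm_sub_le _ _).trans ?_
  rw [Complex.norm_exp_I_mul_ofReal, Complex.norm_exp_I_mul_ofReal]
  norm_num

/-! ### Asymptotics of the averaged coherences -/

lemma tendsto_damping (q a : ℕ) (hq : 1 ≤ q) (γ : ℝ) :
    Tendsto (fun n : ℕ => damping n q a γ) atTop (𝓝 (a * (2 * q * γ ^ 2))) := by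
  have hs : Tendsto (fun n : ℕ => ((n : ℝ) - 2 * a) / n) atTop (𝓝 1) := by
    have h := (tendsto_const_nhds (x := (1 : ℝ))).sub
      (tendsto_const_div_atTop_nhds_zero_nat (2 * a : ℝ))
    rw [sub_zero] at h
    refine h.congr' ?_
    filter_upwards [eventually_gt_atTop 0] with n hn
    have : (n : ℝ) ≠ 0 := by positivity
    field_simp
  -- The damping exponent is the same divided difference of the `q`-th power, taken between `1` and
  -- `s = (n - 2a)/n`.
  have hcont : Continuous fun s : ℝ => a * γ * phaseRate q γ 1 1 s := by
    unfold phaseRate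
    fun_prop
  have h := (hcont.tendsto 1).comp hs
  rw [phaseRate_self] at h
  have hlim : (a : ℝ) * γ * (2 * q * 1 * γ * 1 ^ (q - 1)) = a * (2 * q * γ ^ 2) := by
    rw [one_pow]; ring
  rw [hlim] at h
  refine h.congr' ?_
  filter_upwards [eventually_gt_atTop 0] with n hn
  have hn' : (n : ℝ) ≠ 0 := by positivity
  simp only [Function.comp_apply]
  set s : ℝ := ((n : ℝ) - 2 * a) / n with hs'
  have h1 : (n : ℝ) - 2 * a = s * n := by rw [hs']; field_simp
  have h2 : (n : ℝ) * (1 - s) = 2 * a := by linarith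
  obtain ⟨r, rfl⟩ := Nat.exists_eq_add_of_le hq
  rw [damping, phaseRate, h1, mul_pow]
  have h3 : (n : ℝ) ^ (1 + r) - s ^ (1 + r) * (n : ℝ) ^ (1 + r) =
      2 * a * (∑ i ∈ Finset.range (1 + r), (1 : ℝ) ^ i * s ^ (1 + r - 1 - i)) * (n : ℝ) ^ r := by
    have := geom_sum₂_mul (1 : ℝ) s (1 + r)
    rw [one_pow] at this
    rw [← h2]
    linear_combination -(n : ℝ) ^ (1 + r) * this
  rw [h3, Nat.add_sub_cancel_left]
  field_simp

/-- A pointwise bound with Chebyshev built in. If the magnetization is within `(τ/2) n^c` of its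
mean, continuity of the phase rate gives `ε`; otherwise the trivial bound `2` is absorbed by the
quadratic term. -/
lemma eventually_phase_close (q : ℕ) (hq : 1 ≤ q) (γ δ c Λ : ℝ) (hc : c ∈ Set.Ioo (1 / 2 : ℝ) 1)
    (k lam : ℕ → ℝ) (hkc : k =O[atTop] fun n : ℕ => (n : ℝ) ^ c)
    (hlam : Tendsto (fun n : ℕ => lam n / (n : ℝ) ^ ((1 - c) * ((q : ℝ) - 1))) atTop (𝓝 Λ))
    {ε : ℝ} (hε : 0 < ε) :
    ∃ M : ℝ, ∀ᶠ n : ℕ in atTop, ∀ (A : Finset (Fin n)) (x : Spins n), A.card ≤ 2 →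
      ‖Complex.exp (Complex.I * (signalPhase q γ (lam n) A x : ℂ)) -
        Complex.exp (Complex.I * (((∑ i ∈ A, sgn (x i)) * (2 * q * Λ * γ *
          (k n / (n : ℝ) ^ c * Real.sin (2 * δ)) ^ (q - 1)) : ℝ) : ℂ))‖ ≤
        ε + M / (n : ℝ) ^ (2 * c) * (∑ i, (sgn (x i) - k n / n * Real.sin (2 * δ))) ^ 2 := by
  obtain ⟨K, hK⟩ := hkc.bound
  -- Half of `ε`, because the error in the rate is multiplied by `|σ| ≤ 2`.
  obtain ⟨τ, hτ, hclose⟩ := exists_phaseRate_close q γ (max K |Λ|) (half_pos hε)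
  refine ⟨2 / (τ / 2) ^ 2, ?_⟩
  have hnc : Tendsto (fun n : ℕ => (n : ℝ) ^ c) atTop atTop :=
    (tendsto_rpow_atTop (by linarith [hc.1])).comp tendsto_natCast_atTop_atTop
  -- With `n^c ≥ 8/τ`, flipping `A` moves the rescaled magnetization by `2|σ|/n^c ≤ 4/n^c ≤ τ/2`.
  filter_upwards [hK, eventually_gt_atTop 0, hnc.eventually_ge_atTop (8 / τ),
    Metric.tendsto_nhds.1 hlam τ hτ] with n hKn hn hbig hL A x hA
  have hn' : (0 : ℝ) < n := by exact_mod_cast hn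
  have hN : 0 < (n : ℝ) ^ c := Real.rpow_pos_of_pos hn' c
  set N := (n : ℝ) ^ c with hNdef
  set t₀ := k n / N * Real.sin (2 * δ) with ht₀
  set m := ∑ i, sgn (x i) with hm
  set σ := ∑ i ∈ A, sgn (x i) with hσ
  have hdev : ∑ i, (sgn (x i) - k n / n * Real.sin (2 * δ)) = m - t₀ * N := by
    rw [Finset.sum_sub_distrib, ← hm, ht₀]
    simp only [Finset.sum_const, Finset.card_univ, Fintype.card_fin, nsmul_eq_mul]
    field_simp
  have hσ2 : |σ| ≤ 2 := by
    refine (Finset.abs_sum_le_sum_abs _ _).trans ?_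
    simp only [abs_sgn, Finset.sum_const, nsmul_eq_mul, mul_one]
    exact_mod_cast hA
  have hN2 : (n : ℝ) ^ (2 * c) = N ^ 2 := by
    rw [mul_comm, Real.rpow_mul hn'.le, Real.rpow_two]
  rw [hdev, hN2]
  have hM : 0 ≤ 2 / (τ / 2) ^ 2 / N ^ 2 * (m - t₀ * N) ^ 2 := by positivity
  by_cases hsmall : |m - t₀ * N| ≤ τ / 2 * N
  · refine le_trans ?_ (le_add_of_nonneg_right hM)
    refine (norm_exp_I_sub_le _ _).trans ?_
    rw [signalPhase_eq hn hq γ (lam n) c, ← hσ, ← hm, ← phaseRate_self, ← mul_sub, abs_mul]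
    have ht : |m / N - t₀| ≤ τ / 2 := by
      rw [div_sub' hN.ne', abs_div, abs_of_pos hN, div_le_iff₀ hN, mul_comm N]
      exact hsmall
    have hs : |(m - 2 * σ) / N - t₀| ≤ τ := by
      have h1 : (m - 2 * σ) / N - t₀ = (m / N - t₀) - 2 * σ / N := by ring
      have h2 : |2 * σ / N| ≤ τ / 2 := by
        rw [abs_div, abs_of_pos hN, div_le_iff₀ hN, abs_mul, abs_two]
        rw [div_le_iff₀ hτ] at hbig
        linarith
      rw [h1]
      refine (abs_sub _ _).trans ?_
      linarith
    have ht₀K : |t₀| ≤ max K |Λ| := by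
      refine le_trans ?_ (le_max_left _ _)
      have h1 : |k n / N| ≤ K := by
        rw [abs_div, abs_of_pos hN, div_le_iff₀ hN]
        simpa [abs_of_pos hN] using hKn
      rw [ht₀, abs_mul]
      exact (mul_le_of_le_one_right (abs_nonneg _) (Real.abs_sin_le_one _)).trans h1
    have h := hclose Λ t₀ (lam n / (n : ℝ) ^ ((1 - c) * ((q : ℝ) - 1))) (m / N)
      ((m - 2 * σ) / N) (le_max_right _ _) ht₀K (by simpa [Real.dist_eq] using hL.le)
      (ht.trans (by linarith)) hs
    calc _ ≤ 2 * (ε / 2) := mul_le_mul hσ2 h (abs_nonneg _) zero_le_two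
      _ = ε := by ring
  · refine (norm_exp_I_sub_le_two _ _).trans ?_
    push Not at hsmall
    have h1 : (τ / 2 * N) ^ 2 ≤ (m - t₀ * N) ^ 2 := by
      rw [← sq_abs (m - t₀ * N)]
      exact pow_le_pow_left₀ (by positivity) hsmall.le 2
    have h2 : 2 ≤ 2 / (τ / 2) ^ 2 / N ^ 2 * (m - t₀ * N) ^ 2 := by
      rw [div_div, div_mul_eq_mul_div, le_div_iff₀ (by positivity), ← mul_pow]
      linarith
    linarith

/-- The average of `∏_B x_j` times the coherence phase over independent spins. -/
noncomputable def spinAverage {n : ℕ} (q : ℕ) (γ lam μ : ℝ) (A B : Finset (Fin n)) : ℂ :=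
  ∑ x : Spins n, ((∏ i, spinWeight μ A i (x i) : ℝ) : ℂ) * ((∏ i ∈ B, sgn (x i) : ℝ) *
    Complex.exp (Complex.I * (signalPhase q γ lam A x : ℂ)))

lemma abs_sin_mul_le {p : ℝ} (hp : p ∈ Set.Icc (0 : ℝ) 1) (δ : ℝ) :
    |p * Real.sin (2 * δ)| ≤ p := by
  rw [abs_mul, abs_of_nonneg hp.1]
  exact mul_le_of_le_one_right hp.1 (Real.abs_sin_le_one _)

lemma div_mem_Icc {n : ℕ} {a : ℝ} (ha : a ∈ Set.Icc (0 : ℝ) n) : a / n ∈ Set.Icc (0 : ℝ) 1 :=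
  ⟨div_nonneg ha.1 n.cast_nonneg, div_le_one_of_le₀ ha.2 n.cast_nonneg⟩

/-- The pointwise phase bound is averaged: the variance is `O(n)` and is divided by `n^(2c)`, so `c
> 1/2` makes it vanish. The linearized phase is then averaged exactly by `sum_spinWeight_mul_exp`.
-/
lemma eventually_spinAverage_close (q : ℕ) (hq : 1 ≤ q) (γ δ c Λ : ℝ)
    (hc : c ∈ Set.Ioo (1 / 2 : ℝ) 1) (k lam : ℕ → ℝ)
    (hk : ∀ n : ℕ, k n ∈ Set.Icc (0 : ℝ) (n : ℝ)) (hkc : k =O[atTop] fun n : ℕ => (n : ℝ) ^ c)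
    (hlam : Tendsto (fun n : ℕ => lam n / (n : ℝ) ^ ((1 - c) * ((q : ℝ) - 1))) atTop (𝓝 Λ))
    {ε : ℝ} (hε : 0 < ε) :
    ∀ᶠ n : ℕ in atTop, ∀ A B : Finset (Fin n), A ⊆ B → A.card ≤ 2 →
      ‖spinAverage q γ (lam n) (k n / n * Real.sin (2 * δ)) A B -
        (Complex.I * Real.sin (2 * q * Λ * γ *
          (k n / (n : ℝ) ^ c * Real.sin (2 * δ)) ^ (q - 1))) ^ A.card *
            ((k n / n * Real.sin (2 * δ) : ℝ) : ℂ) ^ (B \ A).card‖ ≤ ε := by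
  obtain ⟨M, hM⟩ := eventually_phase_close q hq γ δ c Λ hc k lam hkc hlam (half_pos hε)
  -- The `8` comes from `4 * n + 4 ≤ 8 * n` for `n ≥ 1`.
  have hlim : Tendsto (fun n : ℕ => |M| * (8 * (n : ℝ) ^ (-(2 * c - 1)))) atTop (𝓝 0) := by
    have h := ((tendsto_rpow_neg_atTop (y := 2 * c - 1) (by linarith [hc.1])).comp
      tendsto_natCast_atTop_atTop).const_mul 8 |>.const_mul |M|
    simpa using h
  filter_upwards [hM, eventually_gt_atTop 0, hlim.eventually_le_const (half_pos hε)]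
    with n hMn hn hsmall A B hAB hA
  have hn' : (1 : ℝ) ≤ n := by exact_mod_cast hn
  have hn0 : (0 : ℝ) < n := by linarith
  set μ := k n / n * Real.sin (2 * δ) with hμ
  have hμ1 : |μ| ≤ 1 := (abs_sin_mul_le (div_mem_Icc (hk n)) δ).trans (div_mem_Icc (hk n)).2
  have hp : ∀ x : Spins n, 0 ≤ ∏ i, spinWeight μ A i (x i) := fun x =>
    Finset.prod_nonneg fun i _ => spinWeight_nonneg hμ1 A i (x i)
  rw [← sum_spinWeight_mul_exp μ _ hAB, spinAverage, ← Finset.sum_sub_distrib]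
  calc _ ≤ ∑ x : Spins n, (∏ i, spinWeight μ A i (x i)) *
        (ε / 2 + M / (n : ℝ) ^ (2 * c) * (∑ i, (sgn (x i) - μ)) ^ 2) := by
        refine (norm_sum_le _ _).trans (Finset.sum_le_sum fun x _ => ?_)
        rw [← mul_sub, ← mul_sub, norm_mul, norm_mul, Complex.norm_real, Complex.norm_real,
          Real.norm_of_nonneg (hp x), Real.norm_eq_abs, Finset.abs_prod,
          Finset.prod_congr rfl fun i _ => abs_sgn (x i), Finset.prod_const_one, one_mul]
        exact mul_le_mul_of_nonneg_left (hMn A x hA) (hp x)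
    _ = ε / 2 + M / (n : ℝ) ^ (2 * c) *
        ∑ x : Spins n, (∏ i, spinWeight μ A i (x i)) * (∑ i, (sgn (x i) - μ)) ^ 2 := by
        simp only [mul_add, Finset.sum_add_distrib, ← Finset.sum_mul, sum_prod_spinWeight, one_mul]
        rw [Finset.mul_sum]
        congr 1
        exact Finset.sum_congr rfl fun x _ => mul_left_comm _ _ _
    _ ≤ ε / 2 + |M| / (n : ℝ) ^ (2 * c) * (8 * n) := by
        have h1 := sum_spinWeight_mul_sq_le hμ1 hA
        have h2 : 0 ≤ ∑ x : Spins n, (∏ i, spinWeight μ A i (x i)) *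
            (∑ i, (sgn (x i) - μ)) ^ 2 :=
          Finset.sum_nonneg fun x _ => mul_nonneg (hp x) (sq_nonneg _)
        gcongr
        · exact le_abs_self M
        · linarith
    _ = ε / 2 + |M| * (8 * (n : ℝ) ^ (-(2 * c - 1))) := by
        have h3 : (n : ℝ) ^ (-(2 * c - 1)) = n / (n : ℝ) ^ (2 * c) := by
          rw [neg_sub, Real.rpow_sub hn0, Real.rpow_one]
        rw [h3]; ring
    _ ≤ ε := by linarith

/-- The disorder average of `∑ x, (∏_B x_j) ⟨φ|x⟩⟨flip A x|φ⟩`. -/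
noncomputable def coherenceAverage {n : ℕ} (q : ℕ) (γ δ p lam : ℝ) (A B : Finset (Fin n)) : ℂ :=
  ((1 - p + p * Real.cos (2 * δ)) ^ A.card * Real.exp (-damping n q A.card γ) : ℝ) *
    spinAverage q γ lam (p * Real.sin (2 * δ)) A B

/-- The role of `c < 1`: the biased fraction vanishes, so the mean spin `μ` tends to `0` and the
angle factor of each flipped site to `1`. -/
lemma tendsto_div_of_isBigO {c : ℝ} (hc : c < 1) {k : ℕ → ℝ}
    (hkc : k =O[atTop] fun n : ℕ => (n : ℝ) ^ c) :
    Tendsto (fun n : ℕ => k n / n) atTop (𝓝 0) := by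
  have h1 : (fun n : ℕ => (n : ℝ) ^ c) =o[atTop] fun n : ℕ => (n : ℝ) := by
    refine (isLittleO_iff_tendsto' ?_).2 ?_
    · filter_upwards [eventually_gt_atTop 0] with n hn h
      exact absurd h (by positivity)
    · refine ((tendsto_rpow_neg_atTop (sub_pos.2 hc)).comp tendsto_natCast_atTop_atTop).congr' ?_
      filter_upwards [eventually_gt_atTop 0] with n hn
      rw [Function.comp_apply, neg_sub, Real.rpow_sub_one (by positivity)]
  exact (hkc.trans_isLittleO h1).tendsto_div_nhds_zero

lemma eventually_coherenceAverage_close (q : ℕ) (hq : 1 ≤ q) (γ δ c Λ : ℝ)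
    (hc : c ∈ Set.Ioo (1 / 2 : ℝ) 1) (k lam : ℕ → ℝ)
    (hk : ∀ n : ℕ, k n ∈ Set.Icc (0 : ℝ) (n : ℝ)) (hkc : k =O[atTop] fun n : ℕ => (n : ℝ) ^ c)
    (hlam : Tendsto (fun n : ℕ => lam n / (n : ℝ) ^ ((1 - c) * ((q : ℝ) - 1))) atTop (𝓝 Λ))
    {ε : ℝ} (hε : 0 < ε) :
    ∀ᶠ n : ℕ in atTop, ∀ A B : Finset (Fin n), A ⊆ B → A.card ≤ 2 →
      ‖coherenceAverage q γ δ (k n / n) (lam n) A B -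
        if A = B then (Complex.I * ((Real.exp (-2 * q * γ ^ 2) * Real.sin (2 * q * Λ * γ *
          (k n / (n : ℝ) ^ c * Real.sin (2 * δ)) ^ (q - 1)) : ℝ) : ℂ)) ^ A.card else 0‖ ≤ ε := by
  have hp0 := tendsto_div_of_isBigO hc.2 hkc
  set e := Real.exp (-2 * q * γ ^ 2) with he
  have he1 : e ≤ 1 := Real.exp_le_one_iff.2 (by nlinarith [sq_nonneg γ, q.cast_nonneg (α := ℝ)])
  have he0 : 0 ≤ e := (Real.exp_pos _).le
  have hD : ∀ a : ℕ, Tendsto (fun n : ℕ =>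
      (1 - k n / n + k n / n * Real.cos (2 * δ)) ^ a * Real.exp (-damping n q a γ)) atTop
      (𝓝 (e ^ a)) := by
    intro a
    have h1 : Tendsto (fun n : ℕ => 1 - k n / n + k n / n * Real.cos (2 * δ)) atTop (𝓝 1) := by
      have := (hp0.const_sub 1).add (hp0.mul_const (Real.cos (2 * δ)))
      simpa using this
    have h2 := (h1.pow a).mul ((Real.continuous_exp.tendsto _).comp (tendsto_damping q a hq γ).neg)
    have h3 : (1 : ℝ) ^ a * Real.exp (-(a * (2 * q * γ ^ 2))) = e ^ a := by
      rw [one_pow, one_mul, he, ← Real.exp_nat_mul]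
      congr 1; ring
    rw [h3] at h2
    exact h2
  -- `η ≤ 1` yields `|D| ≤ 2`. The errors below are at most `2η + η` when `A = B` and `2 · 2η`
  -- otherwise, hence `ε / 4`.
  have hη : 0 < min (ε / 4) 1 := lt_min (by linarith) one_pos
  set η := min (ε / 4) 1 with hηdef
  have hηε : η ≤ ε / 4 := min_le_left _ _
  have hη1 : η ≤ 1 := min_le_right _ _
  -- The prefactor depends on `A` only through its cardinality `0`, `1` or `2`, so finitely many
  -- limits give uniformity in `A`.
  have hD' : ∀ᶠ n : ℕ in atTop, ∀ a ∈ Finset.range 3,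
      |(1 - k n / n + k n / n * Real.cos (2 * δ)) ^ a * Real.exp (-damping n q a γ) - e ^ a| ≤ η :=
    (Filter.eventually_all_finset _).2 fun a _ =>
      (Metric.tendsto_nhds.1 (hD a) η hη).mono fun n hn => by simpa [Real.dist_eq] using hn.le
  filter_upwards [hD', hp0.eventually_le_const hη,
    eventually_spinAverage_close q hq γ δ c Λ hc k lam hk hkc hlam hη] with n hDn hpn hS A B hAB hA
  have hDA := hDn A.card (Finset.mem_range.2 (by omega))
  have hSA := hS A B hAB hA
  rw [coherenceAverage]
  set D := (1 - k n / n + k n / n * Real.cos (2 * δ)) ^ A.card *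
    Real.exp (-damping n q A.card γ) with hDdef
  set S := spinAverage q γ (lam n) (k n / n * Real.sin (2 * δ)) A B
  set μ := k n / n * Real.sin (2 * δ) with hμ
  set y := 2 * q * Λ * γ * (k n / (n : ℝ) ^ c * Real.sin (2 * δ)) ^ (q - 1)
  have hea : e ^ A.card ≤ 1 := pow_le_one₀ he0 he1
  have hDle : |D| ≤ 2 := by
    have h1 := abs_le.1 hDA
    have h2 : 0 ≤ e ^ A.card := pow_nonneg he0 _
    rw [abs_le]; constructor <;> linarith
  have hμη : |μ| ≤ η := (abs_sin_mul_le (div_mem_Icc (hk n)) δ).trans hpn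
  have hT : ‖(Complex.I * Real.sin y) ^ A.card‖ ≤ 1 := by
    rw [norm_pow, norm_mul, Complex.norm_I, one_mul, Complex.norm_real]
    exact pow_le_one₀ (norm_nonneg _) (Real.abs_sin_le_one _)
  by_cases h : A = B
  · subst h
    simp only [sdiff_self, Finset.bot_eq_empty, Finset.card_empty, pow_zero, mul_one] at hSA
    have h1 : (Complex.I * ((e * Real.sin y : ℝ) : ℂ)) ^ A.card =
        ((e ^ A.card : ℝ) : ℂ) * (Complex.I * Real.sin y) ^ A.card := by
      push_cast; ring
    have h2 : (D : ℂ) * S - ((e ^ A.card : ℝ) : ℂ) * (Complex.I * Real.sin y) ^ A.card =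
        D * (S - (Complex.I * Real.sin y) ^ A.card) +
          ((D - e ^ A.card : ℝ) : ℂ) * (Complex.I * Real.sin y) ^ A.card := by
      push_cast; ring
    rw [if_pos rfl, h1, h2]
    refine (norm_add_le _ _).trans ?_
    rw [norm_mul, norm_mul, Complex.norm_real, Complex.norm_real, Real.norm_eq_abs,
      Real.norm_eq_abs]
    have h3 := mul_le_mul hDle hSA (norm_nonneg _) zero_le_two
    have h4 := mul_le_mul hDA hT (norm_nonneg _) hη.le
    linarith
  · rw [if_neg h, sub_zero, norm_mul, Complex.norm_real, Real.norm_eq_abs]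
    have hpos : 1 ≤ (B \ A).card := Finset.card_pos.2
      (Finset.sdiff_nonempty.2 fun hBA => h (Finset.Subset.antisymm hAB hBA))
    have h1 : ‖(Complex.I * Real.sin y) ^ A.card * (μ : ℂ) ^ (B \ A).card‖ ≤ η := by
      rw [norm_mul, norm_pow (μ : ℂ), Complex.norm_real, Real.norm_eq_abs]
      have h2 : |μ| ^ (B \ A).card ≤ |μ| :=
        pow_le_of_le_one (abs_nonneg _) (hμη.trans hη1) (by omega)
      calc _ ≤ 1 * |μ| := mul_le_mul hT h2 (by positivity) zero_le_one
        _ ≤ η := by linarith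
    have h3 : ‖S‖ ≤ 2 * η := by
      have := norm_le_norm_add_norm_sub' S
        ((Complex.I * Real.sin y) ^ A.card * (μ : ℂ) ^ (B \ A).card)
      linarith
    have h4 := mul_le_mul hDle h3 (norm_nonneg _) zero_le_two
    linarith

/-! ### Moments of the overlap -/

/-- The sum `∑ x, (∏_B x_j) ⟨φ|x⟩⟨flip A x|φ⟩`. -/
noncomputable def coherenceSum {n q : ℕ} (γ lam : ℝ) (u : Spins n) (A B : Finset (Fin n))
    (ω : (Fin n → ℝ) × Tensor n q) : ℂ :=
  ∑ x : Spins n, ((∏ i ∈ B, sgn (x i) : ℝ) : ℂ) * coherence γ lam u A x ω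

lemma integrable_coherenceSum {n q : ℕ} {p : ℝ} (hp : p ∈ Set.Icc (0 : ℝ) 1)
    (γ δ lam : ℝ) (u : Spins n) (A B : Finset (Fin n)) :
    Integrable (fun ω => coherenceSum γ lam u A B ω) (noiseLaw n q p δ) :=
  integrable_finsetSum _ fun x _ => (integrable_coherence hp γ δ lam u A x).const_mul _

lemma integral_coherenceSum {n q : ℕ} (hn : 0 < n) (hq : 1 ≤ q) {p : ℝ}
    (hp : p ∈ Set.Icc (0 : ℝ) 1) (γ δ lam : ℝ) (u : Spins n) (A B : Finset (Fin n)) :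
    ∫ ω, coherenceSum γ lam u A B ω ∂(noiseLaw n q p δ) = coherenceAverage q γ δ p lam A B := by
  simp only [coherenceSum]
  rw [integral_finsetSum _ fun x _ => (integrable_coherence hp γ δ lam u A x).const_mul _,
    coherenceAverage, spinAverage, Finset.mul_sum]
  refine Finset.sum_congr rfl fun x _ => ?_
  rw [integral_const_mul, integral_coherence hn hq hp]
  ring

lemma sum_mul_signal {n : ℕ} (u : Spins n) (f : Spins n → ℂ) :
    ∑ z, f z = ∑ x : Spins n, f (x * u) :=
  (Equiv.sum_comp (Equiv.mulRight u) f).symm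

lemma first_moment {n q : ℕ} (γ β lam : ℝ) (u : Spins n) (ω : (Fin n → ℝ) × Tensor n q)
    (j : Fin n) :
    ((∑ z, ‖qaoaState γ β lam (u, ω) z‖ ^ 2 * (sgn (z j) * sgn (u j)) : ℝ) : ℂ) =
      Complex.cos (2 * β) * coherenceSum γ lam u ∅ {j} ω -
        Complex.I * Complex.sin (2 * β) * coherenceSum γ lam u {j} {j} ω := by
  have h : (∑ z, ‖qaoaState γ β lam (u, ω) z‖ ^ 2 * (sgn (z j) * sgn (u j)) : ℝ) =
      (∑ z, ‖qaoaState γ β lam (u, ω) z‖ ^ 2 * sgn (z j)) * sgn (u j) := by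
    rw [Finset.sum_mul]
    exact Finset.sum_congr rfl fun z _ => (mul_assoc _ _ _).symm
  have hu : (sgn (u j) : ℂ) * sgn (u j) = 1 := by exact_mod_cast sgn_mul_self (u j)
  rw [h, Complex.ofReal_mul, qaoaState, expect_spin, dotProduct, sum_mul_signal u, Finset.sum_mul]
  simp only [coherenceSum, Finset.mul_sum]
  rw [← Finset.sum_sub_distrib]
  refine Finset.sum_congr rfl fun x _ => ?_
  rw [heisenbergZ_mulVec, ← flip_mul]
  simp only [coherence, preState, flip_empty, Finset.prod_singleton, Pi.star_apply, Pi.mul_apply,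
    sgn_mul, Complex.ofReal_mul]
  linear_combination (star (phaseState γ (cost (spikedTensor lam u ω.2)) (biasedState u ω.1)
    (x * u)) * sgn (x j) * (Complex.cos (2 * β) *
      phaseState γ (cost (spikedTensor lam u ω.2)) (biasedState u ω.1) (x * u) -
    Complex.I * Complex.sin (2 * β) *
      phaseState γ (cost (spikedTensor lam u ω.2)) (biasedState u ω.1) (flip {j} x * u))) * hu

/-- Expanding the two Heisenberg operators gives one term for each `A ⊆ {j, l}`. Since `j ≠ l`,
flipping `j` leaves the sign at `l` unchanged; the last coefficient is `(-i sin 2β)²`. -/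
lemma second_moment {n q : ℕ} (γ β lam : ℝ) (u : Spins n) (ω : (Fin n → ℝ) × Tensor n q)
    {j l : Fin n} (hjl : j ≠ l) :
    ((∑ z, ‖qaoaState γ β lam (u, ω) z‖ ^ 2 *
        ((sgn (z j) * sgn (u j)) * (sgn (z l) * sgn (u l))) : ℝ) : ℂ) =
      Complex.cos (2 * β) ^ 2 * coherenceSum γ lam u ∅ {j, l} ω -
        Complex.I * Complex.sin (2 * β) * Complex.cos (2 * β) *
          (coherenceSum γ lam u {j} {j, l} ω + coherenceSum γ lam u {l} {j, l} ω) -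
        Complex.sin (2 * β) ^ 2 * coherenceSum γ lam u {j, l} {j, l} ω := by
  have h : (∑ z, ‖qaoaState γ β lam (u, ω) z‖ ^ 2 *
        ((sgn (z j) * sgn (u j)) * (sgn (z l) * sgn (u l))) : ℝ) =
      (∑ z, ‖qaoaState γ β lam (u, ω) z‖ ^ 2 * (sgn (z j) * sgn (z l))) *
        (sgn (u j) * sgn (u l)) := by
    rw [Finset.sum_mul]
    exact Finset.sum_congr rfl fun z _ => by ring
  have huj : (sgn (u j) : ℂ) * sgn (u j) = 1 := by exact_mod_cast sgn_mul_self (u j)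
  have hul : (sgn (u l) : ℂ) * sgn (u l) = 1 := by exact_mod_cast sgn_mul_self (u l)
  rw [h, Complex.ofReal_mul, qaoaState, expect_spin_pair, dotProduct, sum_mul_signal u,
    Finset.sum_mul]
  simp only [coherenceSum, ← Finset.sum_add_distrib, Finset.mul_sum]
  rw [← Finset.sum_sub_distrib, ← Finset.sum_sub_distrib]
  refine Finset.sum_congr rfl fun x _ => ?_
  have hl : flip {j} (x * u) l = (x * u) l := by simp [flip_apply, hjl.symm]
  simp only [heisenbergZ_mulVec, hl]
  rw [flip_flip_singleton hjl, ← flip_mul, ← flip_mul, ← flip_mul]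
  simp only [coherence, preState, flip_empty, Finset.prod_pair hjl, Pi.star_apply, Pi.mul_apply,
    sgn_mul, Complex.ofReal_mul]
  generalize phaseState γ (cost (spikedTensor lam u ω.2)) (biasedState u ω.1) = φ
  linear_combination
    (star (φ (x * u)) * sgn (x j) * sgn (x l) * (Complex.cos (2 * β) ^ 2 * φ (x * u) -
      Complex.I * Complex.sin (2 * β) * Complex.cos (2 * β) * (φ (flip {j} x * u) +
        φ (flip {l} x * u)) +
      Complex.I ^ 2 * Complex.sin (2 * β) ^ 2 * φ (flip {j, l} x * u))) *
        (sgn (u j) * sgn (u j) * hul + huj) +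
    star (φ (x * u)) * sgn (x j) * sgn (x l) * Complex.sin (2 * β) ^ 2 *
      φ (flip {j, l} x * u) * Complex.I_sq

/-- From `(R - r)² = (R² - r²) - 2r(R - r)` and total probability one. In this form every summand
with `j ≠ l`, and every summand of the linear part, will have a small average. -/
lemma expect_sq_eq {n q : ℕ} (hn : 0 < n) (γ β lam r : ℝ) (u : Spins n)
    (ω : (Fin n → ℝ) × Tensor n q) :
    ∑ z, ‖qaoaState γ β lam (u, ω) z‖ ^ 2 * (overlap z u - r) ^ 2 =
      1 / (n : ℝ) ^ 2 * ∑ j, ∑ l, (∑ z, ‖qaoaState γ β lam (u, ω) z‖ ^ 2 *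
          ((sgn (z j) * sgn (u j)) * (sgn (z l) * sgn (u l))) - r ^ 2) -
        2 * r / n * ∑ j, (∑ z, ‖qaoaState γ β lam (u, ω) z‖ ^ 2 * (sgn (z j) * sgn (u j)) - r) := by
  have hn' : (n : ℝ) ≠ 0 := by positivity
  have h1 : ∑ j : Fin n, ∑ l : Fin n, (∑ z, ‖qaoaState γ β lam (u, ω) z‖ ^ 2 *
          ((sgn (z j) * sgn (u j)) * (sgn (z l) * sgn (u l))) - r ^ 2) =
      ∑ z, ‖qaoaState γ β lam (u, ω) z‖ ^ 2 * (n * overlap z u) ^ 2 - n ^ 2 * r ^ 2 := by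
    simp only [Finset.sum_sub_distrib, Finset.sum_const, Finset.card_univ, Fintype.card_fin,
      nsmul_eq_mul]
    congr 1
    · simp_rw [Finset.sum_comm (t := (Finset.univ : Finset (Spins n)))]
      refine Finset.sum_congr rfl fun z _ => ?_
      rw [overlap, mul_div_cancel₀ _ hn', pow_two (∑ i, _), Finset.sum_mul_sum, Finset.mul_sum]
      simp only [Finset.mul_sum]
    · ring
  have h2 : ∑ j : Fin n, (∑ z, ‖qaoaState γ β lam (u, ω) z‖ ^ 2 * (sgn (z j) * sgn (u j)) - r) =
      ∑ z, ‖qaoaState γ β lam (u, ω) z‖ ^ 2 * (n * overlap z u) - n * r := by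
    simp only [Finset.sum_sub_distrib, Finset.sum_const, Finset.card_univ, Fintype.card_fin,
      nsmul_eq_mul]
    congr 1
    rw [Finset.sum_comm]
    refine Finset.sum_congr rfl fun z _ => ?_
    rw [overlap, mul_div_cancel₀ _ hn', Finset.mul_sum]
  have h3 := normSq_qaoaState γ β lam (u, ω)
  have h4 : ∑ z, ‖qaoaState γ β lam (u, ω) z‖ ^ 2 * (overlap z u - r) ^ 2 =
      ∑ z, ‖qaoaState γ β lam (u, ω) z‖ ^ 2 * overlap z u ^ 2 -
        2 * r * ∑ z, ‖qaoaState γ β lam (u, ω) z‖ ^ 2 * overlap z u +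
        r ^ 2 * ∑ z, ‖qaoaState γ β lam (u, ω) z‖ ^ 2 := by
    simp only [Finset.mul_sum]
    rw [← Finset.sum_sub_distrib, ← Finset.sum_add_distrib]
    exact Finset.sum_congr rfl fun z _ => by ring
  have h5 : ∑ z, ‖qaoaState γ β lam (u, ω) z‖ ^ 2 * (n * overlap z u) ^ 2 =
      n ^ 2 * ∑ z, ‖qaoaState γ β lam (u, ω) z‖ ^ 2 * overlap z u ^ 2 := by
    rw [Finset.mul_sum]
    exact Finset.sum_congr rfl fun z _ => by ring
  have h6 : ∑ z, ‖qaoaState γ β lam (u, ω) z‖ ^ 2 * (n * overlap z u) =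
      n * ∑ z, ‖qaoaState γ β lam (u, ω) z‖ ^ 2 * overlap z u := by
    rw [Finset.mul_sum]
    exact Finset.sum_congr rfl fun z _ => by ring
  rw [h1, h2, h4, h5, h6, h3]
  field_simp
  ring

lemma norm_cos_ofReal_le (β : ℝ) : ‖Complex.cos (2 * β)‖ ≤ 1 := by
  have : Complex.cos (2 * β) = (Real.cos (2 * β) : ℂ) := by push_cast; rfl
  rw [this, Complex.norm_real]
  exact Real.abs_cos_le_one _

lemma norm_sin_ofReal_le (β : ℝ) : ‖Complex.sin (2 * β)‖ ≤ 1 := by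
  have : Complex.sin (2 * β) = (Real.sin (2 * β) : ℂ) := by push_cast; rfl
  rw [this, Complex.norm_real]
  exact Real.abs_sin_le_one _

/-- The `n` diagonal pairs cost at most `1` each, giving `1/n` after division by `n²`. The four
coherences of a pair cost `4η`, and the linear term costs `2|r| · 2η ≤ 4η`. -/
lemma integral_expect_sq_le {n q : ℕ} (hn : 0 < n) (hq : 1 ≤ q) {p : ℝ}
    (hp : p ∈ Set.Icc (0 : ℝ) 1) (γ β δ lam s η : ℝ) (hs : |s| ≤ 1) (hη : 0 ≤ η)
    (hclose : ∀ A B : Finset (Fin n), A ⊆ B → A.card ≤ 2 →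
      ‖coherenceAverage q γ δ p lam A B -
        if A = B then (Complex.I * (s : ℂ)) ^ A.card else 0‖ ≤ η) (u : Spins n) :
    ∫ ω, (∑ z, ‖qaoaState γ β lam (u, ω) z‖ ^ 2 * (overlap z u - Real.sin (2 * β) * s) ^ 2)
      ∂(noiseLaw n q p δ) ≤ 1 / n + 8 * η := by
  have hprob := isProbabilityMeasure_noiseLaw n q hp δ
  set r := Real.sin (2 * β) * s with hr
  have hr1 : |r| ≤ 1 := by
    rw [hr, abs_mul]
    exact mul_le_one₀ (Real.abs_sin_le_one _) (abs_nonneg _) hs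
  have hrc : (r : ℂ) = Complex.sin (2 * β) * s := by rw [hr]; push_cast; rfl
  have hi := fun A B => integrable_coherenceSum (q := q) hp γ δ lam u A B
  have hκ := norm_cos_ofReal_le β
  have hσ := norm_sin_ofReal_le β
  have hIσ : ‖Complex.I * Complex.sin (2 * β)‖ ≤ 1 := by
    rwa [norm_mul, Complex.norm_I, one_mul]
  have hbd : ∀ a b : ℂ, ‖a‖ ≤ 1 → ‖b‖ ≤ η → ‖a * b‖ ≤ η := fun a b ha hb => by
    rw [norm_mul]
    calc ‖a‖ * ‖b‖ ≤ 1 * η := mul_le_mul ha hb (norm_nonneg _) zero_le_one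
      _ = η := one_mul η
  set m₁ : Fin n → (Fin n → ℝ) × Tensor n q → ℝ := fun j ω =>
    ∑ z, ‖qaoaState γ β lam (u, ω) z‖ ^ 2 * (sgn (z j) * sgn (u j)) with hm₁
  set m₂ : Fin n → Fin n → (Fin n → ℝ) × Tensor n q → ℝ := fun j l ω =>
    ∑ z, ‖qaoaState γ β lam (u, ω) z‖ ^ 2 *
      ((sgn (z j) * sgn (u j)) * (sgn (z l) * sgn (u l))) with hm₂
  have hone : ∀ j ω, m₂ j j ω = 1 := by
    intro j ω
    have h : ∀ z : Spins n, (sgn (z j) * sgn (u j)) * (sgn (z j) * sgn (u j)) = 1 := fun z => by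
      rw [mul_mul_mul_comm, sgn_mul_self, sgn_mul_self, one_mul]
    simp only [hm₂, h, mul_one]
    exact normSq_qaoaState γ β lam (u, ω)
  have hc₁ : ∀ j ω, (m₁ j ω : ℂ) = _ := fun j ω => first_moment γ β lam u ω j
  have hc₂ : ∀ j l, j ≠ l → ∀ ω, (m₂ j l ω : ℂ) = _ := fun j l h ω =>
    second_moment γ β lam u ω h
  have hci₁ : ∀ j, Integrable (fun ω => (m₁ j ω : ℂ)) (noiseLaw n q p δ) := fun j => by
    simp only [hc₁]
    exact ((hi _ _).const_mul _).sub ((hi _ _).const_mul _)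
  have hi₁ : ∀ j, Integrable (m₁ j) (noiseLaw n q p δ) := fun j => (hci₁ j).re
  have hi₂ : ∀ j l, Integrable (m₂ j l) (noiseLaw n q p δ) := fun j l => by
    by_cases h : j = l
    · subst h
      simp only [funext (hone j)]
      exact integrable_const _
    · have : Integrable (fun ω => (m₂ j l ω : ℂ)) (noiseLaw n q p δ) := by
        simp only [hc₂ j l h]
        exact (((hi _ _).const_mul _).sub (((hi _ _).add (hi _ _)).const_mul _)).sub
          ((hi _ _).const_mul _)
      exact this.re
  have hb₁ : ∀ j, |∫ ω, (m₁ j ω - r) ∂(noiseLaw n q p δ)| ≤ 2 * η := fun j => by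
    rw [integral_sub (hi₁ j) (integrable_const _), integral_const, probReal_univ, one_smul,
      ← Real.norm_eq_abs, ← Complex.norm_real, Complex.ofReal_sub, ← integral_complex_ofReal]
    simp only [hc₁]
    rw [integral_sub ((hi _ _).const_mul _) ((hi _ _).const_mul _), integral_const_mul,
      integral_const_mul, integral_coherenceSum hn hq hp, integral_coherenceSum hn hq hp]
    have h0 := hclose ∅ {j} (Finset.empty_subset _) (by simp)
    have h1 := hclose {j} {j} subset_rfl (by simp)
    rw [if_neg (Finset.singleton_ne_empty j).symm, sub_zero] at h0
    rw [if_pos rfl, Finset.card_singleton, pow_one] at h1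
    -- The target `r` is absorbed into the second coherence, since `-(i sin 2β)(i s) = r`. The pair
    -- case below uses `-(sin 2β)² (i s)² = r²` in the same way.
    have heq : Complex.cos (2 * β) * coherenceAverage q γ δ p lam ∅ {j} -
        Complex.I * Complex.sin (2 * β) * coherenceAverage q γ δ p lam {j} {j} - r =
        Complex.cos (2 * β) * coherenceAverage q γ δ p lam ∅ {j} -
        Complex.I * Complex.sin (2 * β) *
          (coherenceAverage q γ δ p lam {j} {j} - Complex.I * s) := by
      rw [hrc]
      linear_combination -Complex.sin (2 * β) * s * Complex.I_mul_I
    rw [heq]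
    refine (norm_sub_le _ _).trans ?_
    linarith [hbd _ _ hκ h0, hbd _ _ hIσ h1]
  have hb₂ : ∀ j l, |∫ ω, (m₂ j l ω - r ^ 2) ∂(noiseLaw n q p δ)| ≤
      (if j = l then 1 else 0) + 4 * η := fun j l => by
    have hr2 : |r| ^ 2 ≤ 1 := pow_le_one₀ (abs_nonneg _) hr1
    rw [sq_abs] at hr2
    by_cases h : j = l
    · subst h
      simp only [hone, integral_const, probReal_univ, one_smul, if_true]
      rw [abs_of_nonneg (by linarith)]
      nlinarith [sq_nonneg r]
    · rw [integral_sub (hi₂ j l) (integrable_const _), integral_const, probReal_univ, one_smul,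
        ← Real.norm_eq_abs, ← Complex.norm_real, Complex.ofReal_sub, ← integral_complex_ofReal]
      simp only [hc₂ j l h]
      have hi' : ∀ (a : ℂ) (A B A' B' : Finset (Fin n)), Integrable (fun ω => a *
          (coherenceSum γ lam u A B ω + coherenceSum γ lam u A' B' ω)) (noiseLaw n q p δ) :=
        fun a A B A' B' => ((hi A B).add (hi A' B')).const_mul a
      have hi'' : ∀ (b a : ℂ) (A B A' B' A'' B'' : Finset (Fin n)), Integrable (fun ω =>
          b * coherenceSum γ lam u A'' B'' ω - a *
          (coherenceSum γ lam u A B ω + coherenceSum γ lam u A' B' ω)) (noiseLaw n q p δ) :=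
        fun b a A B A' B' A'' B'' => ((hi A'' B'').const_mul b).sub (hi' a A B A' B')
      rw [integral_sub (hi'' _ _ _ _ _ _ _ _) ((hi _ _).const_mul _),
        integral_sub ((hi _ _).const_mul _) (hi' _ _ _ _ _), integral_const_mul, integral_const_mul, integral_const_mul, integral_add (hi _ _) (hi _ _)]
      simp only [integral_coherenceSum hn hq hp]
      have hj : ({j} : Finset (Fin n)) ⊆ {j, l} := by simp
      have hl : ({l} : Finset (Fin n)) ⊆ {j, l} := by simp
      have hcard : ({j, l} : Finset (Fin n)).card = 2 := Finset.card_pair h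
      have hne : ∀ i : Fin n, ({i} : Finset (Fin n)) ≠ {j, l} := fun i hi => by
        rw [← hi, Finset.card_singleton] at hcard
        exact absurd hcard (by norm_num)
      have h0 := hclose ∅ {j, l} (Finset.empty_subset _) (by simp)
      have h1 := hclose {j} {j, l} hj (by simp)
      have h2 := hclose {l} {j, l} hl (by simp)
      have h3 := hclose {j, l} {j, l} subset_rfl hcard.le
      rw [if_neg (Finset.insert_ne_empty j {l}).symm, sub_zero] at h0
      rw [if_neg (hne _), sub_zero] at h1 h2
      rw [if_pos rfl, hcard] at h3
      have heq : ∀ a b c d : ℂ, Complex.cos (2 * β) ^ 2 * a -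
          Complex.I * Complex.sin (2 * β) * Complex.cos (2 * β) * (b + c) -
          Complex.sin (2 * β) ^ 2 * d - ((r ^ 2 : ℝ) : ℂ) =
          Complex.cos (2 * β) ^ 2 * a -
          Complex.I * Complex.sin (2 * β) * Complex.cos (2 * β) * b -
          Complex.I * Complex.sin (2 * β) * Complex.cos (2 * β) * c -
          Complex.sin (2 * β) ^ 2 * (d - (Complex.I * s) ^ 2) := by
        intro a b c d
        rw [Complex.ofReal_pow, hrc]
        linear_combination -Complex.sin (2 * β) ^ 2 * s ^ 2 * Complex.I_mul_I
      rw [heq]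
      have hmul : ‖Complex.I * Complex.sin (2 * β) * Complex.cos (2 * β)‖ ≤ 1 := by
        rw [norm_mul]
        exact mul_le_one₀ hIσ (norm_nonneg _) hκ
      have hκ2 : ‖Complex.cos (2 * β) ^ 2‖ ≤ 1 := by
        rw [norm_pow]; exact pow_le_one₀ (norm_nonneg _) hκ
      have hσ2 : ‖Complex.sin (2 * β) ^ 2‖ ≤ 1 := by
        rw [norm_pow]; exact pow_le_one₀ (norm_nonneg _) hσ
      rw [if_neg h, zero_add]
      refine (norm_sub_le _ _).trans ?_
      have h4 := norm_sub_le (Complex.cos (2 * β) ^ 2 * coherenceAverage q γ δ p lam ∅ {j, l} -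
        Complex.I * Complex.sin (2 * β) * Complex.cos (2 * β) *
          coherenceAverage q γ δ p lam {j} {j, l})
        (Complex.I * Complex.sin (2 * β) * Complex.cos (2 * β) *
          coherenceAverage q γ δ p lam {l} {j, l})
      have h5 := norm_sub_le (Complex.cos (2 * β) ^ 2 * coherenceAverage q γ δ p lam ∅ {j, l})
        (Complex.I * Complex.sin (2 * β) * Complex.cos (2 * β) *
          coherenceAverage q γ δ p lam {j} {j, l})
      linarith [hbd _ _ hκ2 h0, hbd _ _ hmul h1, hbd _ _ hmul h2, hbd _ _ hσ2 h3]
  have hn' : (0 : ℝ) < n := by exact_mod_cast hn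
  have hf : ∀ ω, ∑ z, ‖qaoaState γ β lam (u, ω) z‖ ^ 2 * (overlap z u - r) ^ 2 =
      1 / (n : ℝ) ^ 2 * ∑ j, ∑ l, (m₂ j l ω - r ^ 2) - 2 * r / n * ∑ j, (m₁ j ω - r) :=
    fun ω => expect_sq_eq hn γ β lam r u ω
  have hi₁' : ∀ j, Integrable (fun ω => m₁ j ω - r) (noiseLaw n q p δ) := fun j =>
    (hi₁ j).sub (integrable_const _)
  have hi₂' : ∀ j l, Integrable (fun ω => m₂ j l ω - r ^ 2) (noiseLaw n q p δ) := fun j l =>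
    (hi₂ j l).sub (integrable_const _)
  simp only [hf]
  rw [integral_sub, integral_const_mul, integral_const_mul, integral_finsetSum,
    integral_finsetSum]
  · have e₂ : ∑ j, ∫ ω, ∑ l, (m₂ j l ω - r ^ 2) ∂(noiseLaw n q p δ) ≤ n + n ^ 2 * (4 * η) := by
      calc _ ≤ ∑ j : Fin n, ∑ l : Fin n, ((if j = l then 1 else 0) + 4 * η) := by
            refine Finset.sum_le_sum fun j _ => ?_
            rw [integral_finsetSum _ fun l _ => hi₂' j l]
            exact Finset.sum_le_sum fun l _ => (le_abs_self _).trans (hb₂ j l)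
        _ = n + n ^ 2 * (4 * η) := by
            simp [Finset.sum_add_distrib]
            ring
    have e₁ : |∑ j, ∫ ω, (m₁ j ω - r) ∂(noiseLaw n q p δ)| ≤ n * (2 * η) := by
      refine (Finset.abs_sum_le_sum_abs _ _).trans ((Finset.sum_le_sum fun j _ => hb₁ j).trans ?_)
      simp
    have e₃ : -(2 * r / n * ∑ j, ∫ ω, (m₁ j ω - r) ∂(noiseLaw n q p δ)) ≤ 4 * η := by
      refine (neg_le_abs _).trans ?_
      rw [abs_mul, abs_div, abs_mul, abs_two, abs_of_pos hn']
      calc _ ≤ 2 * 1 / n * (n * (2 * η)) := by gcongr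
        _ = 4 * η := by field_simp; ring
    have e₄ : 1 / (n : ℝ) ^ 2 * ∑ j, ∫ ω, ∑ l, (m₂ j l ω - r ^ 2) ∂(noiseLaw n q p δ) ≤
        1 / n + 4 * η := by
      calc _ ≤ 1 / (n : ℝ) ^ 2 * (n + n ^ 2 * (4 * η)) := by gcongr
        _ = _ := by field_simp
    linarith
  · exact fun j _ => hi₁' j
  · exact fun j _ => integrable_finsetSum _ fun l _ => hi₂' j l
  · exact (integrable_finsetSum _ fun j _ => integrable_finsetSum _ fun l _ =>
      hi₂' j l).const_mul _
  · exact (integrable_finsetSum _ fun j _ => hi₁' j).const_mul _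

/-! ### Convergence in probability -/

lemma integral_bornMeasure {n : ℕ} (ψ : Spins n → ℂ) (f : Spins n → ℝ) :
    ∫ z, f z ∂(bornMeasure ψ) = ∑ z, ‖ψ z‖ ^ 2 * f z := by
  rw [bornMeasure, integral_finsetSum_measure fun z _ =>
    (integrable_dirac enorm_lt_top).smul_measure ENNReal.ofReal_ne_top]
  refine Finset.sum_congr rfl fun z _ => ?_
  rw [integral_smul_measure, integral_dirac, ENNReal.toReal_ofReal (sq_nonneg _), smul_eq_mul]

lemma abs_overlap_le {n : ℕ} (z u : Spins n) : |overlap z u| ≤ 1 := by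
  rw [overlap, abs_div, Nat.abs_cast]
  refine div_le_one_of_le₀ ((Finset.abs_sum_le_sum_abs _ _).trans ?_) n.cast_nonneg
  simp [abs_mul]

lemma measurable_overlap {n q : ℕ} :
    Measurable fun x : Disorder n q × Spins n => overlap x.2 x.1.1 := by
  have hs : Measurable sgn := measurable_of_countable sgn
  unfold overlap
  fun_prop

/-- Markov's inequality for the squared deviation, after disintegrating the joint law into
measurement, noise and signal. The bound `M` holds for each `u`, so averaging over `u` preserves it.
-/
lemma jointLaw_abs_sub_le {n q : ℕ} {p : ℝ} (hp : p ∈ Set.Icc (0 : ℝ) 1) (γ β δ lam r M ε : ℝ)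
    (hε : 0 < ε)
    (hM : ∀ u : Spins n, ∫ ω, (∑ z, ‖qaoaState γ β lam (u, ω) z‖ ^ 2 * (overlap z u - r) ^ 2)
      ∂(noiseLaw n q p δ) ≤ M) :
    jointLaw n q γ β δ p lam {x | ε ≤ |overlap x.2 x.1.1 - r|} ≤ ENNReal.ofReal (M / ε ^ 2) := by
  have hD := isProbabilityMeasure_disorderLaw n q hp δ
  have hJ := isProbabilityMeasure_jointLaw n q γ β δ lam hp
  have hN := isProbabilityMeasure_noiseLaw n q hp δ
  have hint : Integrable (fun x : Disorder n q × Spins n => (overlap x.2 x.1.1 - r) ^ 2)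
      (jointLaw n q γ β δ p lam) := by
    refine Integrable.of_bound ((measurable_overlap.sub_const r).pow_const 2).aestronglyMeasurable
      ((1 + |r|) ^ 2) (Eventually.of_forall fun x => ?_)
    rw [norm_pow, Real.norm_eq_abs]
    exact pow_le_pow_left₀ (abs_nonneg _)
      ((abs_sub _ _).trans (add_le_add_left (abs_overlap_le _ _) _)) 2
  have hle : ∫ x, (overlap x.2 x.1.1 - r) ^ 2 ∂(jointLaw n q γ β δ p lam) ≤ M := by
    rw [jointLaw] at hint ⊢
    rw [Measure.integral_compProd hint]
    have h1 : Integrable (fun ω : Disorder n q => ∫ z, (overlap z ω.1 - r) ^ 2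
        ∂(measurementKernel n q γ β lam ω)) (disorderLaw n q p δ) := hint.integral_compProd
    have h2 : ∀ ω : Disorder n q, ∫ z, (overlap z ω.1 - r) ^ 2
        ∂(measurementKernel n q γ β lam ω) =
        ∑ z, ‖qaoaState γ β lam ω z‖ ^ 2 * (overlap z ω.1 - r) ^ 2 := fun ω =>
      integral_bornMeasure _ _
    simp only [h2] at h1 ⊢
    change Integrable _ ((PMF.uniformOfFintype (Spins n)).toMeasure.prod (noiseLaw n q p δ)) at h1
    change ∫ ω, _ ∂((PMF.uniformOfFintype (Spins n)).toMeasure.prod (noiseLaw n q p δ)) ≤ M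
    rw [integral_prod _ h1]
    refine (integral_mono h1.integral_prod_left (integrable_const M) hM).trans ?_
    simp
  have hmarkov := mul_meas_ge_le_integral_of_nonneg
    (Eventually.of_forall fun _ => sq_nonneg _) hint (ε ^ 2)
  have hset : {x : Disorder n q × Spins n | ε ≤ |overlap x.2 x.1.1 - r|} =
      {x | ε ^ 2 ≤ (overlap x.2 x.1.1 - r) ^ 2} := by
    ext x
    simp only [Set.mem_ofPred_eq]
    rw [← sq_abs (overlap x.2 x.1.1 - r), pow_le_pow_iff_left₀ hε.le (abs_nonneg _) two_ne_zero]
  rw [hset, ← ENNReal.ofReal_toReal (measure_ne_top _ _)]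
  refine ENNReal.ofReal_le_ofReal ?_
  rw [le_div_iff₀ (by positivity), mul_comm]
  exact hmarkov.trans hle

theorem tendsto_overlap (q : ℕ) (hq : 1 ≤ q) (γ β δ c Λ : ℝ) (hc : c ∈ Set.Ioo (1 / 2 : ℝ) 1)
    (k lam : ℕ → ℝ) (hk : ∀ n : ℕ, k n ∈ Set.Icc (0 : ℝ) (n : ℝ))
    (hkc : k =O[atTop] fun n : ℕ => (n : ℝ) ^ c)
    (hlam : Tendsto (fun n : ℕ => lam n / (n : ℝ) ^ ((1 - c) * ((q : ℝ) - 1))) atTop (𝓝 Λ))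
    {ε : ℝ} (hε : 0 < ε) :
    Tendsto (fun n : ℕ => jointLaw n q γ β δ (k n / n) (lam n)
      {x | ε ≤ |overlap x.2 x.1.1 -
        Real.exp (-2 * q * γ ^ 2) * Real.sin (2 * β) *
          Real.sin (2 * q * Λ * γ * (k n / (n : ℝ) ^ c * Real.sin (2 * δ)) ^ (q - 1))|})
      atTop (𝓝 0) := by
  rw [ENNReal.tendsto_nhds_zero]
  intro κ hκ
  -- The tolerance `κ` may be infinite, so a positive real below it is used.
  obtain ⟨κ', hκ'0, hκ'⟩ : ∃ κ' : ℝ, 0 < κ' ∧ ENNReal.ofReal κ' ≤ κ := by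
    obtain ⟨a, ha0, ha⟩ := ENNReal.lt_iff_exists_nnreal_btwn.1 hκ
    exact ⟨a, by exact_mod_cast ha0, by simpa using ha.le⟩
  -- The mean square must be at most `κ' ε²`: half is allotted to `8η`, half to `1/n`.
  have hη : 0 < κ' * ε ^ 2 / 16 := by positivity
  filter_upwards [eventually_coherenceAverage_close q hq γ δ c Λ hc k lam hk hkc hlam hη,
    eventually_gt_atTop 0, tendsto_one_div_atTop_nhds_zero_nat.eventually_le_const
      (show (0 : ℝ) < κ' * ε ^ 2 / 2 by positivity)] with n hclose hn hsmall
  set y := 2 * q * Λ * γ * (k n / (n : ℝ) ^ c * Real.sin (2 * δ)) ^ (q - 1)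
  have hs : |Real.exp (-2 * q * γ ^ 2) * Real.sin y| ≤ 1 := by
    rw [abs_mul, Real.abs_exp]
    exact mul_le_one₀ (Real.exp_le_one_iff.2
      (by nlinarith [sq_nonneg γ, q.cast_nonneg (α := ℝ)])) (abs_nonneg _)
      (Real.abs_sin_le_one _)
  have hp := div_mem_Icc (hk n)
  have h := jointLaw_abs_sub_le hp γ β δ (lam n) _ _ ε hε
    (integral_expect_sq_le hn hq hp γ β δ (lam n) _ _ hs hη.le hclose)
  have hr : Real.exp (-2 * q * γ ^ 2) * Real.sin (2 * β) * Real.sin y =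
      Real.sin (2 * β) * (Real.exp (-2 * q * γ ^ 2) * Real.sin y) := by ring
  rw [hr]
  refine (h.trans (ENNReal.ofReal_le_ofReal ?_)).trans hκ'
  rw [div_le_iff₀ (by positivity)]
  linarith

end QAOA

theorem mainTheorem2 (q : ℕ) (hq : 1 ≤ q) (γ β δ c Λ : ℝ)
    (hγ : 0 < γ) (hβ : β ∈ Set.Icc 0 (2 * Real.pi)) (hδ : δ ∈ Set.Icc 0 (Real.pi / 4))
    (hc : c ∈ Set.Ioo (1 / 2 : ℝ) 1)
    (k lam : ℕ → ℝ)
    (hk : ∀ n : ℕ, k n ∈ Set.Icc (0 : ℝ) (n : ℝ))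
    (hkc : k =Θ[atTop] fun n : ℕ => (n : ℝ) ^ c)
    (hlam : Tendsto (fun n : ℕ => lam n / (n : ℝ) ^ ((1 - c) * ((q : ℝ) - 1))) atTop (𝓝 Λ)) :
    (∀ ε : ℝ, 0 < ε →
      Tendsto (fun n : ℕ => QAOA.jointLaw n q γ β δ (k n / n) (lam n)
        {x | ε ≤ |QAOA.overlap x.2 x.1.1 -
          Real.exp (-2 * q * γ ^ 2) * Real.sin (2 * β) *
            Real.sin (2 * q * Λ * γ * (k n / (n : ℝ) ^ c * Real.sin (2 * δ)) ^ (q - 1))|})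
        atTop (𝓝 0)) ∧
    (Tendsto (fun n : ℕ => k n / (n : ℝ) ^ c) atTop (𝓝 1) →
      ∀ ε : ℝ, 0 < ε →
        Tendsto (fun n : ℕ => QAOA.jointLaw n q γ β δ (k n / n) (lam n)
          {x | ε ≤ |QAOA.overlap x.2 x.1.1 -
            Real.exp (-2 * q * γ ^ 2) * Real.sin (2 * β) *
              Real.sin (2 * q * Λ * γ * Real.sin (2 * δ) ^ (q - 1))|})
          atTop (𝓝 0)) := by
  have key := fun (ε : ℝ) (hε : 0 < ε) =>
    QAOA.tendsto_overlap q hq γ β δ c Λ hc k lam hk hkc.isBigO hlam hε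
  refine ⟨key, fun hk1 ε hε => ?_⟩
  have hcont : Continuous fun t : ℝ => Real.exp (-2 * q * γ ^ 2) * Real.sin (2 * β) *
      Real.sin (2 * q * Λ * γ * (t * Real.sin (2 * δ)) ^ (q - 1)) := by fun_prop
  have hlim := (hcont.tendsto 1).comp hk1
  simp only [one_mul] at hlim
  -- Once the `n`-dependent centre is within `ε / 2` of its limit, a deviation `ε` from the limit
  -- forces a deviation `ε / 2` from the centre.
  refine tendsto_of_tendsto_of_tendsto_of_le_of_le' tendsto_const_nhds (key (ε / 2) (half_pos hε))
    (Eventually.of_forall fun _ => zero_le) ?_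
  filter_upwards [Metric.tendsto_nhds.1 hlim (ε / 2) (half_pos hε)] with n hn
  refine measure_mono fun x hx => ?_
  simp only [Set.mem_ofPred_eq, Function.comp_apply, Real.dist_eq] at hx hn ⊢
  have h := abs_sub_le (QAOA.overlap x.2 x.1.1)
    (Real.exp (-2 * q * γ ^ 2) * Real.sin (2 * β) *
      Real.sin (2 * q * Λ * γ * (k n / (n : ℝ) ^ c * Real.sin (2 * δ)) ^ (q - 1)))
    (Real.exp (-2 * q * γ ^ 2) * Real.sin (2 * β) *
      Real.sin (2 * q * Λ * γ * Real.sin (2 * δ) ^ (q - 1)))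
  linarith
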